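/- Throughout, $\mathcal A\otimes\mathcal B$ is the minimal (spatial) tensor product of $C^*$-algebras. A category of unital separable $C^*$-algebras has such algebras (possibly carrying additional fixed structure, such as a trace) as objects and unital $*$-homomorphisms as morphisms. For maps $\alpha,\beta$ and a finite set $F$ write $\alpha\approx_{\epsilon,F}\beta$ if $\|\alpha(a)-\beta(a)\|<\epsilon$ for all $a\in F$. Definitions. Let $\mathfrak C,\mathfrak K$ be categories of unital separable $C^*$-algebras and unital $*$-homomorphisms. (1) A sequence $(\mathcal D_n,\varphi_n^m)$ in $\mathfrak C$ is a Fraïssé sequence of $\mathfrak C$ if (U) every $\mathfrak C$-object has a $\mathfrak C$-morphism to some $\mathcal D_n$, and (A) for all $\epsilon>0$, $n$, finite $F\subseteq\mathcal D_n$ and every $\mathfrak C$-morphism $\gamma:\mathcal D_n\to\mathcal B$ there are $m\ge n$ and a $\mathfrak C$-morphism $\eta:\mathcal B\to\mathcal D_m$ with $\varphi_n^m\approx_{\epsilon,F}\eta\circ\gamma$. It is a weak Fraïssé sequence if it satisfies (U) and (WA): for all $\epsilon>0$, $n$, finite $F\subseteq\mathcal D_n$ there is $m\ge n$ such that for every $\mathfrak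 C$-morphism $\gamma:\mathcal D_m\to\mathcal B$ there are $k>m$ and a $\mathfrak C$-morphism $\eta:\mathcal B\to\mathcal D_k$ with $\varphi_n^k\approx_{\epsilon,F}\eta\circ\gamma\circ\varphi_n^m$. A (weak) Fraïssé limit of $\mathfrak C$ is the $C^*$-algebraic inductive limit of a (weak) Fraïssé sequence of $\mathfrak C$. (2) $\mathfrak C$ dominates $\mathfrak K$ if $\mathfrak C$ is a subcategory of $\mathfrak K$, (C) every $\mathfrak K$-object has a $\mathfrak K$-morphism to some $\mathfrak C$-object, and (D) for every $\epsilon>0$, every $\mathfrak K$-morphism $\varphi:\mathcal A\to\mathcal B$ with $\mathcal A\in\mathfrak C$ and every finite $F\subseteq\mathcal A$ there are $\mathcal E\in\mathfrak C$, a $\mathfrak K$-morphism $\beta:\mathcal B\to\mathcal E$ and a $\mathfrak C$-morphism $\alpha:\mathcal A\to\mathcal E$ with $\alpha\approx_{\epsilon,F}\beta\circ\varphi$. It weakly dominates $\mathfrak K$ if it is a subcategory satisfying (C) and (WD): for every $\epsilon>0$, $\mathcal A\in\mathfrak C$ and finite $F\subseteq\mathcal A$ there is a $\mathfrak C$-morphism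 $\zeta:\mathcal A\to\mathcal A'$ such that for every $\mathfrak K$-morphism $\varphi:\mathcal A'\to\mathcal B$ there are $\mathcal E\in\mathfrak C$, a $\mathfrak K$-morphism $\beta:\mathcal B\to\mathcal E$ and a $\mathfrak C$-morphism $\alpha:\mathcal A\to\mathcal E$ with $\alpha\approx_{\epsilon,F}\beta\circ\varphi\circ\zeta$. (3) $\mathfrak K$ is a $\otimes$-expansion of $\mathfrak C$ if $\mathfrak C$ is a subcategory of $\mathfrak K$; $\mathcal A\otimes\mathcal A\in\mathfrak K$ for all $\mathcal A\in\mathfrak C$; $\varphi\otimes\varphi$ is in $\mathfrak K$ for every $\mathfrak C$-morphism $\varphi$; for every $\mathcal A\in\mathfrak C$ the embeddings $\operatorname{id}_{\mathcal A}\otimes1$ and $1\otimes\operatorname{id}_{\mathcal A}$ of $\mathcal A$ into $\mathcal A\otimes\mathcal A$ are in $\mathfrak K$; and for every $\mathcal B\in\mathfrak K$ and unitary $u\in\mathcal B$ the inner automorphism $\operatorname{Ad}_u$ of $\mathcal B$ is in $\mathfrak K$. (4) Unital $*$-homomorphisms $\varphi,\psi:\mathcal A\to\mathcal B$ are approximately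 unitarily equivalent if there are unitaries $u_n\in\mathcal B$ with $\|u_n^*\varphi(a)u_n-\psi(a)\|\to0$ for all $a\in\mathcal A$. A unital separable $C^*$-algebra $\mathcal D$ has approximate inner half-flip if $\operatorname{id}_{\mathcal D}\otimes1$ and $1\otimes\operatorname{id}_{\mathcal D}$, as maps $\mathcal D\to\mathcal D\otimes\mathcal D$, are approximately unitarily equivalent; it is strongly self-absorbing if $\mathcal D\not\cong\mathbb C$ and some $*$-isomorphism $\mathcal D\to\mathcal D\otimes\mathcal D$ is approximately unitarily equivalent to $\operatorname{id}_{\mathcal D}\otimes1$. Theorem. Let $\mathfrak C$ be a category of unital separable $C^*$-algebras and unital $*$-homomorphisms that dominates, or just weakly dominates, a $\otimes$-expansion of itself. If $\mathcal D\not\cong\mathbb C$ is a Fraïssé limit, or just a weak Fraïssé limit, of $\mathfrak C$ and $\mathcal D$ has approximate inner half-flip, then $\mathcal D$ is strongly self-absorbing. -/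

import Mathlib

open scoped TensorProduct
open UniformSpace Filter Topology

universe u v

/-- A unital `*`-representation of `A` on a Hilbert space (of the same size as `A`; this includes
all GNS representations, so there are enough of them to be jointly isometric). -/
structure HilbertRep (A : Type u) [CStarAlgebra A] where
  /-- the Hilbert space -/
  space : Type u
  [normed : NormedAddCommGroup space]
  [innerProd : InnerProductSpace ℂ space]
  [complete : CompleteSpace space]
  /-- the representation -/
  rep : A →⋆ₐ[ℂ] (space →L[ℂ] space)

attribute [instance] HilbertRep.normed HilbertRep.innerProd HilbertRep.complete

namespace HilbertRep

variable {A B A' B' : Type u} [CStarAlgebra A] [CStarAlgebra B] [CStarAlgebra A'] [CStarAlgebra B']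

/-- Pull back a representation along a unital `*`-homomorphism. -/
noncomputable def comap (ρ : HilbertRep B) (φ : A →⋆ₐ[ℂ] B) : HilbertRep A where
  space := ρ.space
  rep := ρ.rep.comp φ

/-- The representation `ρ ⊗ σ` of the algebraic tensor product, determined by
`a ⊗ b ↦ ρ(a) ⊗ σ(b)`. It acts on the algebraic tensor product of the two Hilbert spaces with its
inner product; this is dense in the Hilbert space tensor product, so operator norms agree. -/
noncomputable def tensor (ρ : HilbertRep A) (σ : HilbertRep B) :
    A ⊗[ℂ] B →ₐ[ℂ] (ρ.space ⊗[ℂ] σ.space →L[ℂ] ρ.space ⊗[ℂ] σ.space) :=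
  Algebra.TensorProduct.algHomOfLinearMapTensorProduct
    (TensorProduct.lift
      (LinearMap.mk₂ ℂ (fun a b => TensorProduct.mapL (ρ.rep a) (σ.rep b))
        (fun a₁ a₂ b => by rw [map_add, TensorProduct.mapL_add_left])
        (fun c a b => by rw [map_smul, TensorProduct.mapL_smul_left])
        (fun a b₁ b₂ => by rw [map_add, TensorProduct.mapL_add_right])
        (fun c a b => by rw [map_smul, TensorProduct.mapL_smul_right])))
    (fun a₁ a₂ b₁ b₂ => by
      simp only [TensorProduct.lift.tmul, LinearMap.mk₂_apply, map_mul]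
      exact TensorProduct.mapL_mul _ _ _ _)
    (by
      simp only [TensorProduct.lift.tmul, LinearMap.mk₂_apply, map_one]
      exact TensorProduct.mapL_id_id)

theorem tensor_tmul (ρ : HilbertRep A) (σ : HilbertRep B) (a : A) (b : B) :
    ρ.tensor σ (a ⊗ₜ b) = TensorProduct.mapL (ρ.rep a) (σ.rep b) := rfl

theorem tensor_comap (ρ : HilbertRep A') (σ : HilbertRep B') (φ : A →⋆ₐ[ℂ] A') (ψ : B →⋆ₐ[ℂ] B')
    (x : A ⊗[ℂ] B) :
    (ρ.comap φ).tensor (σ.comap ψ) x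
      = ρ.tensor σ (Algebra.TensorProduct.map φ.toAlgHom ψ.toAlgHom x) := by
  induction x with
  | zero => simp only [map_zero]; rfl
  | tmul a b => rfl
  | add x y hx hy => rw [map_add, map_add, map_add, hx, hy]; rfl

theorem inner_tensor_left (ρ : HilbertRep A) (σ : HilbertRep B) (x : A ⊗[ℂ] B)
    (ξ η : ρ.space ⊗[ℂ] σ.space) :
    Inner.inner ℂ (ρ.tensor σ (star x) ξ) η = Inner.inner ℂ ξ (ρ.tensor σ x η) := by
  induction x with
  | zero => simp
  | add x y hx hy => simp only [star_add, map_add, add_apply, inner_add_left,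
      inner_add_right, hx, hy]
  | tmul a b =>
    rw [TensorProduct.star_tmul, tensor_tmul, tensor_tmul]
    induction ξ with
    | zero => simp
    | add ξ₁ ξ₂ h₁ h₂ => rw [map_add, inner_add_left, inner_add_left, h₁, h₂]
    | tmul h k =>
      induction η with
      | zero => simp
      | add η₁ η₂ h₁ h₂ => rw [map_add, inner_add_right, inner_add_right, h₁, h₂]
      | tmul h' k' =>
        simp only [TensorProduct.mapL_tmul, TensorProduct.inner_tmul, map_star,
          ContinuousLinearMap.star_eq_adjoint, ContinuousLinearMap.adjoint_inner_left]

theorem norm_tensor_sq_le (ρ : HilbertRep A) (σ : HilbertRep B) (x : A ⊗[ℂ] B) :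
    ‖ρ.tensor σ x‖ ^ 2 ≤ ‖ρ.tensor σ (star x * x)‖ := by
  have h0 : 0 ≤ ‖ρ.tensor σ (star x * x)‖ := ContinuousLinearMap.opNorm_nonneg _
  have h : ‖ρ.tensor σ x‖ ≤ √‖ρ.tensor σ (star x * x)‖ := by
    refine ContinuousLinearMap.opNorm_le_bound _ (Real.sqrt_nonneg _) fun ξ => ?_
    refine abs_le_of_sq_le_sq' ?_ (by positivity) |>.2
    rw [mul_pow, Real.sq_sqrt h0]
    have h1 : ((‖ρ.tensor σ x ξ‖ ^ 2 : ℝ) : ℂ) = Inner.inner ℂ (ρ.tensor σ (star x * x) ξ) ξ := by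
      rw [map_mul, mul_apply_eq_comp, inner_tensor_left, Complex.ofReal_pow]
      exact (inner_self_eq_norm_sq_to_K (𝕜 := ℂ) (ρ.tensor σ x ξ)).symm
    have h2 : ‖ρ.tensor σ x ξ‖ ^ 2 = ‖Inner.inner ℂ (ρ.tensor σ (star x * x) ξ) ξ‖ := by
      rw [← h1, Complex.norm_real, Real.norm_of_nonneg (by positivity)]
    rw [h2]
    calc _ ≤ ‖ρ.tensor σ (star x * x) ξ‖ * ‖ξ‖ := norm_inner_le_norm _ _
      _ ≤ ‖ρ.tensor σ (star x * x)‖ * ‖ξ‖ * ‖ξ‖ := by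
        gcongr; exact ContinuousLinearMap.le_opNorm _ _
      _ = _ := by ring
  calc _ ≤ √‖ρ.tensor σ (star x * x)‖ ^ 2 := by gcongr
    _ = _ := Real.sq_sqrt h0

theorem norm_tensor_tmul_le (ρ : HilbertRep A) (σ : HilbertRep B) (a : A) (b : B) :
    ‖ρ.tensor σ (a ⊗ₜ b)‖ ≤ ‖a‖ * ‖b‖ := by
  rw [tensor_tmul]
  refine (TensorProduct.norm_mapL_le _ _).trans ?_
  gcongr
  · exact NonUnitalStarAlgHom.norm_apply_le ρ.rep a
  · exact NonUnitalStarAlgHom.norm_apply_le σ.rep b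

/-- There is always the representation on the zero space. -/
instance : Nonempty (HilbertRep A) :=
  ⟨{ space := PUnit
     rep :=
      { toFun := fun _ => 0
        map_one' := Subsingleton.elim _ _
        map_mul' := fun _ _ => Subsingleton.elim _ _
        map_zero' := rfl
        map_add' := fun _ _ => Subsingleton.elim _ _
        commutes' := fun _ => Subsingleton.elim _ _
        map_star' := fun _ => Subsingleton.elim _ _ } }⟩

end HilbertRep

section Spatial

variable (A B : Type u) [CStarAlgebra A] [CStarAlgebra B]

/-- The algebraic tensor product, as a type to be equipped with the spatial norm. -/
def AlgTensor : Type u := A ⊗[ℂ] B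

namespace AlgTensor

noncomputable instance : Ring (AlgTensor A B) := inferInstanceAs (Ring (A ⊗[ℂ] B))
noncomputable instance : Algebra ℂ (AlgTensor A B) := inferInstanceAs (Algebra ℂ (A ⊗[ℂ] B))
noncomputable instance : StarRing (AlgTensor A B) := inferInstanceAs (StarRing (A ⊗[ℂ] B))
instance : StarModule ℂ (AlgTensor A B) := inferInstanceAs (StarModule ℂ (A ⊗[ℂ] B))

variable {A B}

/-- The spatial (minimal) norm: `‖x‖ = sup ‖(ρ ⊗ σ)(x)‖` over all Hilbert space representations
`ρ` of `A` and `σ` of `B`. -/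
noncomputable instance : Norm (AlgTensor A B) where
  norm x := ⨆ p : HilbertRep A × HilbertRep B, ‖p.1.tensor p.2 x‖

theorem norm_def (x : AlgTensor A B) :
    ‖x‖ = ⨆ p : HilbertRep A × HilbertRep B, ‖p.1.tensor p.2 x‖ := rfl

theorem bddAbove (x : AlgTensor A B) :
    BddAbove (Set.range fun p : HilbertRep A × HilbertRep B => ‖p.1.tensor p.2 x‖) := by
  suffices ∃ C, ∀ p : HilbertRep A × HilbertRep B, ‖p.1.tensor p.2 x‖ ≤ C by
    obtain ⟨C, hC⟩ := this
    exact ⟨C, by rintro _ ⟨p, rfl⟩; exact hC p⟩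
  change A ⊗[ℂ] B at x
  induction x with
  | zero => exact ⟨0, fun p => by rw [map_zero]; exact ContinuousLinearMap.opNorm_zero.le⟩
  | tmul a b => exact ⟨‖a‖ * ‖b‖, fun p => p.1.norm_tensor_tmul_le p.2 a b⟩
  | add x y hx hy =>
    obtain ⟨C, hC⟩ := hx
    obtain ⟨D, hD⟩ := hy
    refine ⟨C + D, fun p => ?_⟩
    rw [map_add]
    exact (ContinuousLinearMap.opNorm_add_le _ _).trans (add_le_add (hC p) (hD p))

theorem norm_tensor_le (p : HilbertRep A × HilbertRep B) (x : AlgTensor A B) :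
    ‖p.1.tensor p.2 x‖ ≤ ‖x‖ := le_ciSup (bddAbove x) p

theorem norm_le {x : AlgTensor A B} {C : ℝ}
    (h : ∀ p : HilbertRep A × HilbertRep B, ‖p.1.tensor p.2 x‖ ≤ C) : ‖x‖ ≤ C := ciSup_le h

/-- The spatial norm as a ring seminorm. -/
noncomputable def ringSeminorm : RingSeminorm (AlgTensor A B) where
  toFun x := ‖x‖
  map_zero' := le_antisymm
    (norm_le fun p => by
      have : p.1.tensor p.2 (0 : AlgTensor A B) = 0 := map_zero (p.1.tensor p.2)
      rw [this]; exact ContinuousLinearMap.opNorm_zero.le)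
    ((ContinuousLinearMap.opNorm_nonneg _).trans (norm_tensor_le (Classical.arbitrary _) _))
  add_le' x y := norm_le fun p => by
    have : p.1.tensor p.2 (x + y) = p.1.tensor p.2 x + p.1.tensor p.2 y :=
      map_add (p.1.tensor p.2) _ _
    rw [this]
    exact (ContinuousLinearMap.opNorm_add_le _ _).trans
      (add_le_add (norm_tensor_le p x) (norm_tensor_le p y))
  neg' x := by
    rw [norm_def, norm_def]
    congr 1; ext p
    have : p.1.tensor p.2 (-x) = - p.1.tensor p.2 x := map_neg (p.1.tensor p.2) _
    rw [this]; exact ContinuousLinearMap.opNorm_neg _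
  mul_le' x y := norm_le fun p => by
    have : p.1.tensor p.2 (x * y) = p.1.tensor p.2 x * p.1.tensor p.2 y :=
      map_mul (p.1.tensor p.2) _ _
    rw [this]
    exact (ContinuousLinearMap.opNorm_comp_le _ _).trans
      (mul_le_mul (norm_tensor_le p x) (norm_tensor_le p y) (ContinuousLinearMap.opNorm_nonneg _)
        ((ContinuousLinearMap.opNorm_nonneg _).trans (norm_tensor_le p x)))

noncomputable instance : SeminormedRing (AlgTensor A B) where
  __ := (inferInstance : Ring (AlgTensor A B))
  __ := (inferInstance : Norm (AlgTensor A B))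
  __ := (ringSeminorm (A := A) (B := B)).toSeminormedRing

noncomputable instance : NormedAlgebra ℂ (AlgTensor A B) where
  norm_smul_le c x := norm_le fun p => by
    have : p.1.tensor p.2 (c • x) = c • p.1.tensor p.2 x := map_smul (p.1.tensor p.2) _ _
    rw [this]
    exact (ContinuousLinearMap.opNorm_smul_le _ _).trans
      (mul_le_mul_of_nonneg_left (norm_tensor_le p x) (norm_nonneg c))

variable (A B) in
/-- `a ↦ a ⊗ 1` into the algebraic tensor product. -/
noncomputable def inl : A →⋆ₐ[ℂ] AlgTensor A B where
  __ := (Algebra.TensorProduct.includeLeft : A →ₐ[ℂ] A ⊗[ℂ] B)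
  map_star' a := by
    change star a ⊗ₜ[ℂ] (1 : B) = star (a ⊗ₜ[ℂ] (1 : B))
    rw [TensorProduct.star_tmul, star_one]

variable (A B) in
/-- `b ↦ 1 ⊗ b` into the algebraic tensor product. -/
noncomputable def inr : B →⋆ₐ[ℂ] AlgTensor A B where
  __ := (Algebra.TensorProduct.includeRight : B →ₐ[ℂ] A ⊗[ℂ] B)
  map_star' b := by
    change (1 : A) ⊗ₜ[ℂ] star b = star ((1 : A) ⊗ₜ[ℂ] b)
    rw [TensorProduct.star_tmul, star_one]

/-- `φ ⊗ ψ` on algebraic tensor products. -/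
noncomputable def map {A' B' : Type u} [CStarAlgebra A'] [CStarAlgebra B']
    (φ : A →⋆ₐ[ℂ] A') (ψ : B →⋆ₐ[ℂ] B') : AlgTensor A B →⋆ₐ[ℂ] AlgTensor A' B' where
  __ := (Algebra.TensorProduct.map φ.toAlgHom ψ.toAlgHom : A ⊗[ℂ] B →ₐ[ℂ] A' ⊗[ℂ] B')
  map_star' x := by
    change Algebra.TensorProduct.map φ.toAlgHom ψ.toAlgHom (star (x : A ⊗[ℂ] B))
      = star (Algebra.TensorProduct.map φ.toAlgHom ψ.toAlgHom (x : A ⊗[ℂ] B))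
    change A ⊗[ℂ] B at x
    induction x with
    | zero => simp
    | add x y hx hy => simp only [star_add, map_add, hx, hy]
    | tmul a b => exact congrArg₂ (fun a b => a ⊗ₜ[ℂ] b) (map_star φ a) (map_star ψ b)

theorem norm_map_le {A' B' : Type u} [CStarAlgebra A'] [CStarAlgebra B']
    (φ : A →⋆ₐ[ℂ] A') (ψ : B →⋆ₐ[ℂ] B') (x : AlgTensor A B) : ‖map φ ψ x‖ ≤ ‖x‖ :=
  norm_le fun p => by
    exact (congrArg norm (HilbertRep.tensor_comap p.1 p.2 φ ψ x)).ge.trans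
      (norm_tensor_le (p.1.comap φ, p.2.comap ψ) x)

theorem norm_sq_le (x : AlgTensor A B) : ‖x‖ ^ 2 ≤ ‖star x * x‖ := by
  have h0 : 0 ≤ ‖star x * x‖ := norm_nonneg _
  have : ‖x‖ ≤ √‖star x * x‖ := norm_le fun p =>
    Real.le_sqrt_of_sq_le ((p.1.norm_tensor_sq_le p.2 x).trans (norm_tensor_le p _))
  calc _ ≤ √‖star x * x‖ ^ 2 := by gcongr
    _ = _ := Real.sq_sqrt h0

theorem norm_star (x : AlgTensor A B) : ‖star x‖ = ‖x‖ := by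
  have key : ∀ y : AlgTensor A B, ‖y‖ ≤ ‖star y‖ := fun y => by
    rcases (norm_nonneg y).eq_or_lt with h | h
    · rw [← h]; exact norm_nonneg _
    · have := (norm_sq_le y).trans (norm_mul_le _ _)
      rw [sq] at this
      exact le_of_mul_le_mul_right this h
  exact le_antisymm ((key _).trans (by rw [star_star])) (key x)

end AlgTensor

/-- The minimal (spatial) tensor product of two unital C*-algebras: the completion of the algebraic
tensor product in the spatial norm. -/
def MinTensor : Type u := Completion (AlgTensor A B)

namespace MinTensor

noncomputable instance : NormedRing (MinTensor A B) :=
  inferInstanceAs (NormedRing (Completion (AlgTensor A B)))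

instance : CompleteSpace (MinTensor A B) :=
  inferInstanceAs (CompleteSpace (Completion (AlgTensor A B)))

noncomputable instance : Algebra ℂ (MinTensor A B) :=
  inferInstanceAs (Algebra ℂ (Completion (AlgTensor A B)))

noncomputable instance : NormedAlgebra ℂ (MinTensor A B) where
  norm_smul_le := (inferInstance : NormedSpace ℂ (Completion (AlgTensor A B))).norm_smul_le

variable {A B}

theorem isometry_star : Isometry (star : AlgTensor A B → AlgTensor A B) :=
  AddMonoidHomClass.isometry_of_norm (starAddEquiv : AlgTensor A B ≃+ AlgTensor A B)
    AlgTensor.norm_star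

noncomputable instance : Star (MinTensor A B) where
  star := Completion.map (star : AlgTensor A B → AlgTensor A B)

theorem continuous_star : Continuous (star : MinTensor A B → MinTensor A B) :=
  Completion.continuous_map

/-- The canonical map from the algebraic tensor product. -/
noncomputable def ofAlg (x : AlgTensor A B) : MinTensor A B :=
  (Completion.coe' x : Completion (AlgTensor A B))

theorem norm_ofAlg (x : AlgTensor A B) : ‖ofAlg x‖ = ‖x‖ := Completion.norm_coe x

theorem star_ofAlg (x : AlgTensor A B) : star (ofAlg x) = ofAlg (star x) :=
  Completion.map_coe isometry_star.uniformContinuous x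

theorem ofAlg_add (x y : AlgTensor A B) : ofAlg (x + y) = ofAlg x + ofAlg y :=
  Completion.coe_add x y

theorem ofAlg_mul (x y : AlgTensor A B) : ofAlg (x * y) = ofAlg x * ofAlg y :=
  Completion.coe_mul x y

theorem ofAlg_smul (c : ℂ) (x : AlgTensor A B) : ofAlg (c • x) = c • ofAlg x :=
  Completion.coe_smul c x

theorem continuous_ofAlg : Continuous (ofAlg : AlgTensor A B → MinTensor A B) :=
  Completion.continuous_coe _

theorem denseRange_ofAlg : DenseRange (ofAlg : AlgTensor A B → MinTensor A B) :=
  Completion.denseRange_coe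

noncomputable instance : StarRing (MinTensor A B) where
  star_involutive x := congrFun (denseRange_ofAlg.equalizer
    (continuous_star.comp continuous_star) continuous_id
    (by ext x; simp [star_ofAlg])) x
  star_mul x y := by
    refine denseRange_ofAlg.induction_on₂ (p := fun x y => star (x * y) = star y * star x)
      (isClosed_eq (continuous_star.comp continuous_mul)
        ((continuous_star.comp continuous_snd).mul (continuous_star.comp continuous_fst)))
      (fun x y => ?_) x y
    rw [← ofAlg_mul, star_ofAlg, star_ofAlg, star_ofAlg, star_mul, ofAlg_mul]
  star_add x y := by
    refine denseRange_ofAlg.induction_on₂ (p := fun x y => star (x + y) = star x + star y)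
      (isClosed_eq (continuous_star.comp continuous_add)
        ((continuous_star.comp continuous_fst).add (continuous_star.comp continuous_snd)))
      (fun x y => ?_) x y
    rw [← ofAlg_add, star_ofAlg, star_ofAlg, star_ofAlg, star_add, ofAlg_add]

noncomputable instance : CStarAlgebra (MinTensor A B) where
  norm_mul_self_le x := by
    refine denseRange_ofAlg.induction_on (p := fun x : MinTensor A B => ‖x‖ * ‖x‖ ≤ ‖star x * x‖)
      x (isClosed_le (continuous_norm.mul continuous_norm)
        (continuous_norm.comp (continuous_star.mul continuous_id))) fun x => ?_
    rw [star_ofAlg, ← ofAlg_mul, norm_ofAlg, norm_ofAlg, ← sq]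
    exact AlgTensor.norm_sq_le x
  star_smul c x := by
    refine denseRange_ofAlg.induction_on
      (p := fun x : MinTensor A B => star (c • x) = star c • star x)
      x (isClosed_eq (continuous_star.comp (continuous_const_smul c))
        (continuous_star.const_smul (star c))) fun x => ?_
    rw [← ofAlg_smul, star_ofAlg, star_ofAlg, ← ofAlg_smul, star_smul]

variable (A B) in
/-- The canonical unital `*`-homomorphism from the algebraic to the minimal tensor product. -/
noncomputable def ofAlgHom : AlgTensor A B →⋆ₐ[ℂ] MinTensor A B where
  toFun := ofAlg
  map_one' := Completion.coe_one _
  map_mul' := ofAlg_mul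
  map_zero' := Completion.coe_zero
  map_add' := ofAlg_add
  commutes' c := by
    rw [Algebra.algebraMap_eq_smul_one, Algebra.algebraMap_eq_smul_one, ofAlg_smul]
    congr 1
  map_star' x := (star_ofAlg x).symm

variable (A B) in
/-- The first factor embedding `id ⊗ 1 : a ↦ a ⊗ 1`. -/
noncomputable def inl : A →⋆ₐ[ℂ] MinTensor A B := (ofAlgHom A B).comp (AlgTensor.inl A B)

variable (A B) in
/-- The second factor embedding `1 ⊗ id : b ↦ 1 ⊗ b`. -/
noncomputable def inr : B →⋆ₐ[ℂ] MinTensor A B := (ofAlgHom A B).comp (AlgTensor.inr A B)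

variable {A' B' : Type u} [CStarAlgebra A'] [CStarAlgebra B']

theorem uniformContinuous_map (φ : A →⋆ₐ[ℂ] A') (ψ : B →⋆ₐ[ℂ] B') :
    UniformContinuous (AlgTensor.map φ ψ) :=
  (AddMonoidHomClass.lipschitz_of_bound (AlgTensor.map φ ψ) 1 fun x => by
    rw [one_mul]; exact AlgTensor.norm_map_le φ ψ x).uniformContinuous

/-- The underlying function of `φ ⊗ ψ`: the continuous extension from the algebraic tensor
product. -/
noncomputable def mapFun (φ : A →⋆ₐ[ℂ] A') (ψ : B →⋆ₐ[ℂ] B') (x : MinTensor A B) :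
    MinTensor A' B' :=
  Completion.map (AlgTensor.map φ ψ) x

theorem continuous_mapFun (φ : A →⋆ₐ[ℂ] A') (ψ : B →⋆ₐ[ℂ] B') : Continuous (mapFun φ ψ) :=
  Completion.continuous_map

theorem mapFun_ofAlg (φ : A →⋆ₐ[ℂ] A') (ψ : B →⋆ₐ[ℂ] B') (x : AlgTensor A B) :
    mapFun φ ψ (ofAlg x) = ofAlg (AlgTensor.map φ ψ x) :=
  Completion.map_coe (uniformContinuous_map φ ψ) x

/-- The tensor product `φ ⊗ ψ` of two unital `*`-homomorphisms. -/
noncomputable def map (φ : A →⋆ₐ[ℂ] A') (ψ : B →⋆ₐ[ℂ] B') :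
    MinTensor A B →⋆ₐ[ℂ] MinTensor A' B' where
  toFun := mapFun φ ψ
  map_one' := by
    rw [← map_one (ofAlgHom A B)]
    exact (mapFun_ofAlg φ ψ 1).trans (by rw [map_one]; exact map_one (ofAlgHom A' B'))
  map_zero' := by
    rw [← map_zero (ofAlgHom A B)]
    exact (mapFun_ofAlg φ ψ 0).trans (by rw [map_zero]; exact map_zero (ofAlgHom A' B'))
  map_mul' x y := by
    refine denseRange_ofAlg.induction_on₂
      (p := fun x y => mapFun φ ψ (x * y) = mapFun φ ψ x * mapFun φ ψ y)
      (isClosed_eq ((continuous_mapFun φ ψ).comp continuous_mul)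
        (((continuous_mapFun φ ψ).comp continuous_fst).mul
          ((continuous_mapFun φ ψ).comp continuous_snd)))
      (fun x y => ?_) x y
    rw [← ofAlg_mul, mapFun_ofAlg, mapFun_ofAlg, mapFun_ofAlg, map_mul, ofAlg_mul]
  map_add' x y := by
    refine denseRange_ofAlg.induction_on₂
      (p := fun x y => mapFun φ ψ (x + y) = mapFun φ ψ x + mapFun φ ψ y)
      (isClosed_eq ((continuous_mapFun φ ψ).comp continuous_add)
        (((continuous_mapFun φ ψ).comp continuous_fst).add
          ((continuous_mapFun φ ψ).comp continuous_snd)))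
      (fun x y => ?_) x y
    rw [← ofAlg_add, mapFun_ofAlg, mapFun_ofAlg, mapFun_ofAlg, map_add, ofAlg_add]
  commutes' c := by
    have h := (ofAlgHom A B).commutes' c
    have h' := (ofAlgHom A' B').commutes' c
    rw [← h, ← h', ← (AlgTensor.map φ ψ).commutes' c]
    exact mapFun_ofAlg φ ψ _
  map_star' x := by
    refine denseRange_ofAlg.induction_on
      (p := fun x => mapFun φ ψ (star x) = star (mapFun φ ψ x)) x
      (isClosed_eq ((continuous_mapFun φ ψ).comp continuous_star)
        (continuous_star.comp (continuous_mapFun φ ψ))) fun x => ?_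
    rw [star_ofAlg, mapFun_ofAlg, mapFun_ofAlg, star_ofAlg, map_star]

theorem map_inl (φ : A →⋆ₐ[ℂ] A') (ψ : B →⋆ₐ[ℂ] B') (a : A) :
    map φ ψ (inl A B a) = inl A' B' (φ a) := by
  refine (mapFun_ofAlg φ ψ _).trans ?_
  change ofAlg (Algebra.TensorProduct.map φ.toAlgHom ψ.toAlgHom (a ⊗ₜ[ℂ] (1 : B)))
    = ofAlg ((φ a) ⊗ₜ[ℂ] (1 : B'))
  simp

theorem map_inr (φ : A →⋆ₐ[ℂ] A') (ψ : B →⋆ₐ[ℂ] B') (b : B) :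
    map φ ψ (inr A B b) = inr A' B' (ψ b) := by
  refine (mapFun_ofAlg φ ψ _).trans ?_
  change ofAlg (Algebra.TensorProduct.map φ.toAlgHom ψ.toAlgHom ((1 : A) ⊗ₜ[ℂ] b))
    = ofAlg ((1 : A') ⊗ₜ[ℂ] (ψ b))
  simp

end MinTensor
end Spatial

/-- Two unital `*`-homomorphisms into a unital C*-algebra `B` (which is its own multiplier algebra)
are approximately unitarily equivalent. -/
def ApproxUnitarilyEquivalent {A B : Type*} [CStarAlgebra A] [CStarAlgebra B]
    (φ ψ : A →⋆ₐ[ℂ] B) : Prop :=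
  ∃ w : ℕ → unitary B, ∀ a : A,
    Tendsto (fun n => ‖star (w n : B) * φ a * (w n : B) - ψ a‖) atTop (𝓝 0)

/-- Approximate inner half-flip: `id ⊗ 1` and `1 ⊗ id` are approximately unitarily equivalent. -/
def HasApproxInnerHalfFlip (D : Type u) [CStarAlgebra D] : Prop :=
  ApproxUnitarilyEquivalent (MinTensor.inl D D) (MinTensor.inr D D)

/-- `D` is separable, not isomorphic to `ℂ`, and some `*`-isomorphism `D → D ⊗ D` is approximately
unitarily equivalent to `id ⊗ 1`. -/
def StronglySelfAbsorbing (D : Type u) [CStarAlgebra D] : Prop :=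
  TopologicalSpace.SeparableSpace D ∧ ¬ Nonempty (D ≃⋆ₐ[ℂ] ℂ) ∧
    ∃ Φ : D ≃⋆ₐ[ℂ] MinTensor D D,
      ApproxUnitarilyEquivalent (Φ : D →⋆ₐ[ℂ] MinTensor D D) (MinTensor.inl D D)

/-- A category of unital C*-algebras and unital `*`-homomorphisms. The family `A` lists the
underlying algebras of the possible objects. It need not be injective: objects may carry additional
structure (a fixed trace, say), and then several objects share one algebra. -/
structure CStarCategory {ι : Type v} (A : ι → Type u) [∀ i, CStarAlgebra (A i)] where
  /-- the objects -/
  obj : Set ι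
  /-- the morphisms from `i` to `j` -/
  hom : ∀ i j, Set (A i →⋆ₐ[ℂ] A j)
  source_mem : ∀ {i j} {φ : A i →⋆ₐ[ℂ] A j}, φ ∈ hom i j → i ∈ obj
  target_mem : ∀ {i j} {φ : A i →⋆ₐ[ℂ] A j}, φ ∈ hom i j → j ∈ obj
  id_mem : ∀ {i}, i ∈ obj → StarAlgHom.id ℂ (A i) ∈ hom i i
  comp_mem : ∀ {i j k} {ψ : A j →⋆ₐ[ℂ] A k} {φ : A i →⋆ₐ[ℂ] A j},
    ψ ∈ hom j k → φ ∈ hom i j → ψ.comp φ ∈ hom i k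

namespace CStarCategory

variable {ι : Type v} {A : ι → Type u} [∀ i, CStarAlgebra (A i)]

/-- `C` is a subcategory of `K`. -/
def IsSubcategory (C K : CStarCategory A) : Prop :=
  C.obj ⊆ K.obj ∧ ∀ i j, C.hom i j ⊆ K.hom i j

/-- A `C`-sequence `(D_n, φ_n^m)`. -/
structure Sequence (C : CStarCategory A) where
  /-- the object `D_n` -/
  obj : ℕ → ι
  /-- the connecting morphism `φ_n^m : D_n → D_m` -/
  map : ∀ {n m : ℕ}, n ≤ m → (A (obj n) →⋆ₐ[ℂ] A (obj m))
  map_mem : ∀ {n m : ℕ} (h : n ≤ m), map h ∈ C.hom (obj n) (obj m)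
  map_refl : ∀ n : ℕ, map (le_refl n) = StarAlgHom.id ℂ (A (obj n))
  map_comp : ∀ {n m k : ℕ} (h : n ≤ m) (h' : m ≤ k), (map h').comp (map h) = map (h.trans h')

variable {C : CStarCategory A}

/-- `D` with the maps `φ_n^∞ : D_n → D` is the C*-algebraic inductive limit of the sequence: the
maps are compatible, the union of their ranges is dense, and `‖φ_n^∞(a)‖ = lim_m ‖φ_n^m(a)‖`, that
is, `D` is the completion of the algebraic direct limit in its canonical C*-seminorm. -/
structure Sequence.IsLimit (S : C.Sequence) {D : Type u} [CStarAlgebra D]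
    (φ : ∀ n, A (S.obj n) →⋆ₐ[ℂ] D) : Prop where
  compatible : ∀ {n m : ℕ} (h : n ≤ m), (φ m).comp (S.map h) = φ n
  dense : Dense (⋃ n, Set.range (φ n))
  norm_eq : ∀ (n : ℕ) (a : A (S.obj n)),
    Tendsto (fun k => ‖S.map (Nat.le_add_right n k) a‖) atTop (𝓝 ‖φ n a‖)

/-- Every object of `C` maps to some member of the sequence. -/
def Sequence.Cofinal (S : C.Sequence) : Prop :=
  ∀ i ∈ C.obj, ∃ (n : ℕ) (φ : A i →⋆ₐ[ℂ] A (S.obj n)), φ ∈ C.hom i (S.obj n)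

/-- Fraïssé sequence of `C`. -/
def Sequence.IsFraisse (S : C.Sequence) : Prop :=
  S.Cofinal ∧
  ∀ ε : ℝ, 0 < ε → ∀ (n : ℕ) (F : Finset (A (S.obj n))) (j : ι),
    ∀ γ ∈ C.hom (S.obj n) j, ∃ (m : ℕ) (h : n ≤ m), ∃ η ∈ C.hom j (S.obj m),
      ∀ a ∈ F, ‖S.map h a - η (γ a)‖ < ε

/-- Weak Fraïssé sequence of `C`. -/
def Sequence.IsWeakFraisse (S : C.Sequence) : Prop :=
  S.Cofinal ∧
  ∀ ε : ℝ, 0 < ε → ∀ (n : ℕ) (F : Finset (A (S.obj n))),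
    ∃ (m : ℕ) (h : n ≤ m), ∀ (j : ι), ∀ γ ∈ C.hom (S.obj m) j,
      ∃ (k : ℕ) (h' : m < k), ∃ η ∈ C.hom j (S.obj k),
        ∀ a ∈ F, ‖S.map (h.trans h'.le) a - η (γ (S.map h a))‖ < ε

/-- `D` is a Fraïssé limit of `C`. -/
def IsFraisseLimit (C : CStarCategory A) (D : Type u) [CStarAlgebra D] : Prop :=
  ∃ S : C.Sequence, S.IsFraisse ∧ ∃ φ : ∀ n, A (S.obj n) →⋆ₐ[ℂ] D, S.IsLimit φ

/-- `D` is a weak Fraïssé limit of `C`. -/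
def IsWeakFraisseLimit (C : CStarCategory A) (D : Type u) [CStarAlgebra D] : Prop :=
  ∃ S : C.Sequence, S.IsWeakFraisse ∧ ∃ φ : ∀ n, A (S.obj n) →⋆ₐ[ℂ] D, S.IsLimit φ

/-- Every object of `K` has a `K`-morphism to an object of `C`. -/
def IsCofinalIn (C K : CStarCategory A) : Prop :=
  ∀ i ∈ K.obj, ∃ j ∈ C.obj, (K.hom i j).Nonempty

/-- `C` dominates `K`. -/
def Dominates (C K : CStarCategory A) : Prop :=
  C.IsSubcategory K ∧ C.IsCofinalIn K ∧
  ∀ ε : ℝ, 0 < ε → ∀ i ∈ C.obj, ∀ (j : ι), ∀ φ ∈ K.hom i j, ∀ F : Finset (A i),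
    ∃ k ∈ C.obj, ∃ β ∈ K.hom j k, ∃ α ∈ C.hom i k, ∀ a ∈ F, ‖α a - β (φ a)‖ < ε

/-- `C` weakly dominates `K`. -/
def WeaklyDominates (C K : CStarCategory A) : Prop :=
  C.IsSubcategory K ∧ C.IsCofinalIn K ∧
  ∀ ε : ℝ, 0 < ε → ∀ i ∈ C.obj, ∀ F : Finset (A i),
    ∃ (i' : ι), ∃ ζ ∈ C.hom i i', ∀ (j : ι), ∀ φ ∈ K.hom i' j,
      ∃ k ∈ C.obj, ∃ β ∈ K.hom j k, ∃ α ∈ C.hom i k, ∀ a ∈ F, ‖α a - β (φ (ζ a))‖ < ε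

/-- `K` is a `⊗`-expansion of `C`. For every `C`-object `i` there is a `K`-object `T i` whose algebra
is `A i ⊗ A i` (by means of the `*`-isomorphism `e i`), such that `φ ⊗ φ`, both factor embeddings
and all inner automorphisms are `K`-morphisms. -/
def IsTensorExpansion (K C : CStarCategory A) : Prop :=
  C.IsSubcategory K ∧
  ∃ (T : C.obj → ι) (e : ∀ i : C.obj, MinTensor (A i) (A i) ≃⋆ₐ[ℂ] A (T i)),
    (∀ i, T i ∈ K.obj) ∧
    (∀ (i j : C.obj), ∀ φ ∈ C.hom i j,
      ((e j : MinTensor (A j) (A j) →⋆ₐ[ℂ] A (T j)).comp (MinTensor.map φ φ)).comp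
        ((e i).symm : A (T i) →⋆ₐ[ℂ] MinTensor (A i) (A i)) ∈ K.hom (T i) (T j)) ∧
    (∀ i : C.obj, (e i : MinTensor (A i) (A i) →⋆ₐ[ℂ] A (T i)).comp (MinTensor.inl (A i) (A i))
      ∈ K.hom i (T i)) ∧
    (∀ i : C.obj, (e i : MinTensor (A i) (A i) →⋆ₐ[ℂ] A (T i)).comp (MinTensor.inr (A i) (A i))
      ∈ K.hom i (T i)) ∧
    (∀ j ∈ K.obj, ∀ w : unitary (A j),
      (Unitary.conjStarAlgAut ℂ (A j) w : A j →⋆ₐ[ℂ] A j) ∈ K.hom j j)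

end CStarCategory

/-! The proof has two independent halves, joined by a unital `*`-homomorphism `θ` from D into
ℓ^∞(D)/c₀(D) whose range commutes with the constant sequences.

The Fraïssé half produces `θ`. Send a stage D_m into some A and embed A in A ⊗ A by the first
factor. Weak domination replaces this embedding, up to a small error and a further map, by a
morphism of the category, and the weak Fraïssé property absorbs that morphism into the sequence. So
the first factor is almost the given copy of D_n in D, and the second factor supplies a map into D
that almost commutes with it (`exists_almost_central`). Such maps τ_m : D_m → D need not be
compatible: a ∈ D_n goes to the class of (τ_m(φ_n^m(a)))_m, and the limsup of the norms is at most
lim ‖φ_n^m(a)‖, the norm of the image of a in D (`exists_lift_seqAlgebra`).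

The half-flip half starts with `HasApproxInnerHalfFlip.exists_lift`: commuting maps π₁, π₂ : D → E
are jointly contractive for the spatial norm. Indeed, conjugating by the images in E ⊗ D of the
half-flip unitaries carries π₁(a)π₂(b) ⊗ 1 to π₁(a) ⊗ b in the limit, so no appeal to nuclearity is
needed. Applied to `θ` ⊗ 1 and 1 ⊗ id, it transports the half-flip unitaries to unitaries over D ⊗ D
that commute with D ⊗ 1 and conjugate 1 ⊗ b towards `θ`(b) ⊗ 1. Passing to terms of representing
sequences gives unitaries of D ⊗ D that almost commute with D ⊗ 1 and move any finite set almost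
into D ⊗ 1. The one-sided intertwining argument then perturbs id ⊗ 1, by conjugation with products
of these unitaries, to an isomorphism D → D ⊗ D. -/

/-! ### Faithfulness of Hilbert space representations. -/

section Representations

open scoped ComplexOrder

/-- Positive functionals separate the points of a C*-algebra. -/
theorem CStarAlgebra.exists_positiveLinearMap_ne_zero {B : Type u} [CStarAlgebra B] [PartialOrder B]
    [StarOrderedRing B] {b : B} (hb : 0 ≤ b) (hb0 : b ≠ 0) : ∃ f : B →ₚ[ℂ] ℂ, f b ≠ 0 := by
  have hcl : IsClosed (Set.Ici (0 : B)) := isClosed_Ici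
  have hconv : Convex ℝ (Set.Ici (0 : B)) := convex_Ici 0
  have hmem : -b ∉ Set.Ici (0 : B) := fun h => hb0 (le_antisymm (neg_nonneg.mp h) hb)
  obtain ⟨F, r, hFb, hF⟩ := RCLike.geometric_hahn_banach_point_closed (𝕜 := ℂ) hconv hcl hmem
  have hr : r < 0 := by simpa using hF 0 (Set.mem_Ici.mpr le_rfl)
  -- A functional whose real part is bounded below on a cone is nonnegative there: otherwise a
  -- positive multiple of x attains the value r exactly.
  have hpos : ∀ x : B, 0 ≤ x → 0 ≤ (F x).re := fun x hx => by
    by_contra! hneg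
    have h := hF ((r / (F x).re) • x)
      (Set.mem_Ici.mpr (smul_nonneg (div_nonneg_of_nonpos hr.le hneg.le) hx))
    have e : F ((r / (F x).re) • x) = ((r / (F x).re : ℝ) : ℂ) * F x := by
      rw [← Complex.coe_smul, map_smul, smul_eq_mul]
    rw [e] at h
    simp only [RCLike.re_eq_complex_re, Complex.re_ofReal_mul] at h
    rw [div_mul_cancel₀ _ hneg.ne] at h
    exact lt_irrefl _ h
  -- F is only real-positive on the cone; adding its adjoint functional makes the values on
  -- self-adjoint elements real.
  let G : B →ₗ[ℂ] ℂ :=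
    { toFun := fun x => F x + star (F (star x))
      map_add' := fun x y => by simp only [star_add, map_add]; ring
      map_smul' := fun c x => by
        simp only [star_smul, map_smul, smul_eq_mul, star_mul', star_star, RingHom.id_apply]
        ring }
  have hG : ∀ x : B, IsSelfAdjoint x → G x = ((2 * (F x).re : ℝ) : ℂ) := fun x hx => by
    change F x + star (F (star x)) = _
    rw [hx.star_eq]
    exact Complex.add_conj _
  refine ⟨PositiveLinearMap.mk₀ G fun x hx => ?_, ?_⟩
  · rw [hG x (IsSelfAdjoint.of_nonneg hx)]
    exact_mod_cast mul_nonneg zero_le_two (hpos x hx)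
  · change G b ≠ 0
    rw [hG b (IsSelfAdjoint.of_nonneg hb)]
    have h1 : (F (-b)).re < r := hFb
    rw [map_neg, Complex.neg_re] at h1
    have : (0 : ℝ) < 2 * (F b).re := by linarith
    exact_mod_cast this.ne'

/-- The Hilbert space representations of a C*-algebra are jointly faithful. -/
theorem HilbertRep.exists_rep_ne_zero {B : Type u} [CStarAlgebra B] {b : B} (hb : b ≠ 0) :
    ∃ ρ : HilbertRep B, ρ.rep b ≠ 0 := by
  let := CStarAlgebra.spectralOrder B
  let := CStarAlgebra.spectralOrderedRing B
  obtain ⟨f, hf⟩ := CStarAlgebra.exists_positiveLinearMap_ne_zero (star_mul_self_nonneg b)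
    ((CStarRing.star_mul_self_ne_zero_iff b).mpr hb)
  refine ⟨{ space := f.GNS, rep := f.gnsStarAlgHom }, fun h => hf ?_⟩
  have h1 : f.gnsStarAlgHom b (f.toPreGNS 1 : f.GNS) = 0 := by
    change f.gnsStarAlgHom b = 0 at h
    rw [h]; rfl
  -- The vector of 1 in the GNS space is moved to the vector of b, whose squared norm is f(b*b) ≠ 0.
  have h2 : f.gnsStarAlgHom b (f.toPreGNS 1 : f.GNS) = ((f.toPreGNS b : f.PreGNS) : f.GNS) := by
    simp
  have h3 : ‖f.toPreGNS b‖ = 0 := by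
    rw [← Completion.norm_coe, ← h2, h1, norm_zero]
  have h4 := f.preGNS_norm_sq (f.toPreGNS b)
  rw [h3] at h4
  simpa using h4.symm

end Representations

/-! ### Factor embeddings and generation of the minimal tensor product. -/

namespace MinTensor

variable {A B : Type u} [CStarAlgebra A] [CStarAlgebra B]

/-- A representation ρ nonzero at a and a representation σ nonzero at 1 give ξ, η with ρ(a)ξ ⊗ σ(1)η
≠ 0, which forces the spatial norm of a ⊗ 1 to be positive. Injectivity is what makes the embedding
isometric. -/
theorem injective_inl [Nontrivial B] : Function.Injective (inl A B) := by
  refine (injective_iff_map_eq_zero (inl A B)).mpr fun a ha => ?_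
  by_contra ha0
  obtain ⟨ρ, hρ⟩ := HilbertRep.exists_rep_ne_zero ha0
  obtain ⟨σ, hσ⟩ := HilbertRep.exists_rep_ne_zero (one_ne_zero (α := B))
  obtain ⟨ξ, hξ⟩ := DFunLike.ne_iff.mp hρ
  obtain ⟨η, hη⟩ := DFunLike.ne_iff.mp hσ
  have h0 : ‖(AlgTensor.inl A B a : AlgTensor A B)‖ = 0 := by
    rw [← norm_ofAlg]
    exact norm_eq_zero.mpr ha
  have h1 := AlgTensor.norm_tensor_le (ρ, σ) (AlgTensor.inl A B a)
  rw [h0] at h1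
  have h2 : ‖ρ.tensor σ (a ⊗ₜ (1 : B)) (ξ ⊗ₜ η)‖ = 0 :=
    le_antisymm ((ContinuousLinearMap.le_opNorm _ _).trans
      (mul_nonpos_of_nonpos_of_nonneg h1 (norm_nonneg _))) (norm_nonneg _)
  rw [HilbertRep.tensor_tmul, TensorProduct.mapL_tmul, TensorProduct.norm_tmul] at h2
  rcases mul_eq_zero.mp h2 with h | h
  · exact hξ (norm_eq_zero.mp h)
  · exact hη (norm_eq_zero.mp h)

theorem norm_inl [Nontrivial B] (a : A) : ‖inl A B a‖ = ‖a‖ :=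
  NonUnitalStarAlgHom.norm_map (inl A B) injective_inl a

theorem ofAlg_tmul (a : A) (b : B) :
    ofAlg (a ⊗ₜ[ℂ] b : A ⊗[ℂ] B) = inl A B a * inr A B b := by
  change _ = ofAlg _ * ofAlg _
  rw [← ofAlg_mul]
  congr 1
  change _ = (a ⊗ₜ[ℂ] (1 : B)) * ((1 : A) ⊗ₜ[ℂ] b)
  rw [Algebra.TensorProduct.tmul_mul_tmul, mul_one, one_mul]

theorem commute_inl_inr (a : A) (b : B) : Commute (inl A B a) (inr A B b) := by
  rw [Commute, SemiconjBy, ← ofAlg_tmul]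
  change _ = ofAlg _ * ofAlg _
  rw [← ofAlg_mul]
  congr 1
  change _ = ((1 : A) ⊗ₜ[ℂ] b) * (a ⊗ₜ[ℂ] (1 : B))
  rw [Algebra.TensorProduct.tmul_mul_tmul, mul_one, one_mul]

/-- A closed set that contains the elementary tensors and is closed under addition is everything. -/
theorem induction_closed {p : MinTensor A B → Prop} (hp : IsClosed {x | p x})
    (hadd : ∀ x y, p x → p y → p (x + y)) (htmul : ∀ a b, p (inl A B a * inr A B b))
    (x : MinTensor A B) : p x := by
  refine denseRange_ofAlg.induction_on x hp fun x => ?_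
  change A ⊗[ℂ] B at x
  induction x with
  | zero =>
    have h := htmul 0 0
    rw [map_zero, zero_mul] at h
    have h0 : (ofAlg (0 : AlgTensor A B) : MinTensor A B) = 0 := map_zero (ofAlgHom A B)
    exact h0.symm ▸ h
  | tmul a b => exact (ofAlg_tmul a b).symm ▸ htmul a b
  | add x y hx hy => exact (ofAlg_add (A := A) (B := B) x y).symm ▸ hadd _ _ hx hy

/-- A closed `*`-subalgebra that contains both tensor factors is everything. -/
theorem starSubalgebra_eq_top {S : StarSubalgebra ℂ (MinTensor A B)}
    (hS : IsClosed (S : Set (MinTensor A B))) (hl : ∀ a, inl A B a ∈ S) (hr : ∀ b, inr A B b ∈ S) :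
    S = ⊤ :=
  eq_top_iff.mpr fun x _ => induction_closed (p := (· ∈ S)) hS (fun _ _ => add_mem)
    (fun a b => mul_mem (hl a) (hr b)) x

end MinTensor

/-! ### Extension of contractive homomorphisms by closing their graphs. -/

/-- A contractive relation between C*-algebras that is a `*`-subalgebra with dense first projection
extends to a unital `*`-homomorphism. -/
theorem StarAlgHom.exists_of_contractive_graph {P W : Type*} [CStarAlgebra P] [CStarAlgebra W]
    (Γ : StarSubalgebra ℂ (P × W)) (hΓ : ∀ z ∈ Γ, ‖z.2‖ ≤ ‖z.1‖)
    (hd : Dense (Prod.fst '' (Γ : Set (P × W)))) :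
    ∃ F : P →⋆ₐ[ℂ] W, ∀ z ∈ Γ, F z.1 = z.2 := by
  set Δ := Γ.topologicalClosure with hΔ
  have hle : ∀ z ∈ Δ, ‖z.2‖ ≤ ‖z.1‖ := fun z hz => by
    have hz' : z ∈ closure (Γ : Set (P × W)) := hz
    have hc : IsClosed {z : P × W | ‖z.2‖ ≤ ‖z.1‖} :=
      isClosed_le (continuous_snd.norm) (continuous_fst.norm)
    exact closure_minimal hΓ hc hz'
  have huniq : ∀ p w w', (p, w) ∈ Δ → (p, w') ∈ Δ → w = w' := fun p w w' h h' => by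
    have := hle _ (sub_mem h h')
    simp only [Prod.mk_sub_mk, sub_self, norm_zero] at this
    exact sub_eq_zero.mp (norm_le_zero_iff.mp this)
  -- Contractivity applied to differences turns a convergent sequence of first coordinates into a
  -- Cauchy sequence of second coordinates.
  have hex : ∀ p, ∃ w, (p, w) ∈ Δ := fun p => by
    obtain ⟨s, hs, hsp⟩ := mem_closure_iff_seq_limit.mp (hd p)
    choose z hz hzs using hs
    have hcauchy : CauchySeq fun n => (z n).2 := by
      rw [Metric.cauchySeq_iff']
      intro ε hε
      obtain ⟨N, hN⟩ := Metric.cauchySeq_iff'.mp hsp.cauchySeq ε hε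
      refine ⟨N, fun n hn => ?_⟩
      have h1 := hN n hn
      rw [dist_eq_norm] at h1 ⊢
      rw [← hzs, ← hzs] at h1
      exact (hΓ _ (sub_mem (hz n) (hz N))).trans_lt h1
    obtain ⟨w, hw⟩ := cauchySeq_tendsto_of_complete hcauchy
    refine ⟨w, ?_⟩
    have : Tendsto z atTop (𝓝 (p, w)) := by
      have h1 : Tendsto (fun n => (z n).1) atTop (𝓝 p) := by simpa only [hzs] using hsp
      exact h1.prodMk_nhds hw
    exact mem_closure_of_tendsto this (Eventually.of_forall hz)
  choose F hF using hex
  refine ⟨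
    { toFun := F
      map_one' := huniq _ _ _ (hF 1) (one_mem Δ)
      map_zero' := huniq _ _ _ (hF 0) (zero_mem Δ)
      map_mul' := fun x y => huniq _ _ _ (hF _) (mul_mem (hF x) (hF y))
      map_add' := fun x y => huniq _ _ _ (hF _) (add_mem (hF x) (hF y))
      commutes' := fun c => huniq _ _ _ (hF _) (algebraMap_mem Δ c)
      map_star' := fun x => huniq _ _ _ (hF _) (star_mem (hF x)) }, fun z hz => ?_⟩
  exact huniq _ _ _ (hF z.1) (Γ.le_topologicalClosure hz)

/-- A contractive `*`-homomorphism extends along a `*`-homomorphism with dense range. -/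
theorem StarAlgHom.exists_extension {R P W : Type*} [Ring R] [Algebra ℂ R] [StarRing R]
    [CStarAlgebra P] [CStarAlgebra W] (i : R →⋆ₐ[ℂ] P) (f : R →⋆ₐ[ℂ] W) (hi : DenseRange i)
    (h : ∀ r, ‖f r‖ ≤ ‖i r‖) : ∃ F : P →⋆ₐ[ℂ] W, ∀ r, F (i r) = f r := by
  obtain ⟨F, hF⟩ := StarAlgHom.exists_of_contractive_graph (i.prod f).range
    (by rintro _ ⟨r, rfl⟩; exact h r)
    (hi.mono (by rintro _ ⟨r, rfl⟩; exact ⟨(i r, f r), ⟨r, rfl⟩, rfl⟩))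
  exact ⟨F, fun r => hF (i r, f r) ⟨r, rfl⟩⟩

/-! ### The sequence algebra ℓ^∞(B)/c₀(B). -/

/-- The algebra of bounded sequences in `B`, to be equipped with the seminorm `limsup ‖x n‖`. -/
def BoundedSeq (B : Type u) [CStarAlgebra B] : Type u := BoundedContinuousFunction ℕ B

namespace BoundedSeq

variable {B : Type u} [CStarAlgebra B]

noncomputable instance : Ring (BoundedSeq B) :=
  inferInstanceAs (Ring (BoundedContinuousFunction ℕ B))
noncomputable instance : Algebra ℂ (BoundedSeq B) :=
  inferInstanceAs (Algebra ℂ (BoundedContinuousFunction ℕ B))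
noncomputable instance : StarRing (BoundedSeq B) :=
  inferInstanceAs (StarRing (BoundedContinuousFunction ℕ B))
instance : StarModule ℂ (BoundedSeq B) :=
  inferInstanceAs (StarModule ℂ (BoundedContinuousFunction ℕ B))

instance : FunLike (BoundedSeq B) ℕ B :=
  inferInstanceAs (FunLike (BoundedContinuousFunction ℕ B) ℕ B)

theorem add_apply (x y : BoundedSeq B) (n : ℕ) : (x + y) n = x n + y n := rfl
theorem mul_apply (x y : BoundedSeq B) (n : ℕ) : (x * y) n = x n * y n := rfl
theorem star_apply (x : BoundedSeq B) (n : ℕ) : (star x) n = star (x n) := rfl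
theorem neg_apply (x : BoundedSeq B) (n : ℕ) : (-x) n = -x n := rfl
theorem sub_apply (x y : BoundedSeq B) (n : ℕ) : (x - y) n = x n - y n := rfl
theorem smul_apply (c : ℂ) (x : BoundedSeq B) (n : ℕ) : (c • x) n = c • x n := rfl
theorem zero_apply (n : ℕ) : (0 : BoundedSeq B) n = 0 := rfl
theorem ext {x y : BoundedSeq B} (h : ∀ n, x n = y n) : x = y :=
  BoundedContinuousFunction.ext h

/-- A bounded sequence from a function and a bound. -/
noncomputable def mk (f : ℕ → B) (C : ℝ) (h : ∀ n, ‖f n‖ ≤ C) : BoundedSeq B :=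
  BoundedContinuousFunction.ofNormedAddCommGroupDiscrete f C h

theorem mk_apply (f : ℕ → B) (C : ℝ) (h : ∀ n, ‖f n‖ ≤ C) (n : ℕ) : mk f C h n = f n := rfl

theorem exists_bound (x : BoundedSeq B) : ∃ C, ∀ n, ‖x n‖ ≤ C :=
  ⟨‖(show BoundedContinuousFunction ℕ B from x)‖, fun n =>
    BoundedContinuousFunction.norm_coe_le_norm (show BoundedContinuousFunction ℕ B from x) n⟩

noncomputable instance : Norm (BoundedSeq B) where
  norm x := limsup (fun n => ‖x n‖) atTop

theorem norm_le_of_eventually {x : BoundedSeq B} {c : ℝ} (h : ∀ᶠ n in atTop, ‖x n‖ ≤ c) :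
    ‖x‖ ≤ c :=
  limsup_le_of_le (isCoboundedUnder_le_of_le atTop fun _ => norm_nonneg _) h

theorem eventually_lt_of_norm_lt {x : BoundedSeq B} {c : ℝ} (h : ‖x‖ < c) :
    ∀ᶠ n in atTop, ‖x n‖ < c := by
  obtain ⟨C, hC⟩ := x.exists_bound
  exact eventually_lt_of_limsup_lt h ⟨C, eventually_map.mpr (Eventually.of_forall hC)⟩

theorem norm_nonneg' (x : BoundedSeq B) : 0 ≤ ‖x‖ := by
  by_contra! h
  obtain ⟨n, hn⟩ := (eventually_lt_of_norm_lt h).exists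
  exact (norm_nonneg _).not_gt hn

theorem norm_congr {x y : BoundedSeq B} (h : ∀ᶠ n in atTop, ‖x n‖ = ‖y n‖) : ‖x‖ = ‖y‖ :=
  limsup_congr h

/-- The seminorm `limsup ‖x n‖`. -/
noncomputable def ringSeminorm : RingSeminorm (BoundedSeq B) where
  toFun x := ‖x‖
  map_zero' := le_antisymm
    (norm_le_of_eventually (Eventually.of_forall fun n => by rw [zero_apply, norm_zero]))
    (norm_nonneg' _)
  add_le' x y := by
    refine le_of_forall_pos_le_add fun ε hε => norm_le_of_eventually ?_
    filter_upwards [eventually_lt_of_norm_lt (lt_add_of_pos_right ‖x‖ (half_pos hε)),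
      eventually_lt_of_norm_lt (lt_add_of_pos_right ‖y‖ (half_pos hε))] with n hx hy
    rw [add_apply]
    linarith [norm_add_le (x n) (y n)]
  neg' x := norm_congr (Eventually.of_forall fun n => by rw [neg_apply, norm_neg])
  mul_le' x y := by
    have key : ∀ ε : ℝ, 0 < ε → ‖x * y‖ ≤ (‖x‖ + ε) * (‖y‖ + ε) := fun ε hε => by
      refine norm_le_of_eventually ?_
      filter_upwards [eventually_lt_of_norm_lt (lt_add_of_pos_right ‖x‖ hε),
        eventually_lt_of_norm_lt (lt_add_of_pos_right ‖y‖ hε)] with n hx hy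
      rw [mul_apply]
      exact (norm_mul_le _ _).trans
        (mul_le_mul hx.le hy.le (norm_nonneg _) ((norm_nonneg _).trans hx.le))
    have hlim : Tendsto (fun ε : ℝ => (‖x‖ + ε) * (‖y‖ + ε)) (𝓝[>] 0)
        (𝓝 ((‖x‖ + 0) * (‖y‖ + 0))) :=
      ((by fun_prop : Continuous fun ε : ℝ => (‖x‖ + ε) * (‖y‖ + ε)).tendsto 0).mono_left
        nhdsWithin_le_nhds
    rw [add_zero, add_zero] at hlim
    exact ge_of_tendsto hlim (eventually_nhdsWithin_of_forall fun ε hε => key ε hε)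

noncomputable instance : SeminormedRing (BoundedSeq B) where
  __ := (inferInstance : Ring (BoundedSeq B))
  __ := (inferInstance : Norm (BoundedSeq B))
  __ := (ringSeminorm (B := B)).toSeminormedRing

noncomputable instance : NormedAlgebra ℂ (BoundedSeq B) where
  norm_smul_le c x := by
    refine le_of_forall_pos_le_add fun ε hε => norm_le_of_eventually ?_
    have hc : 0 < ‖c‖ + 1 := by positivity
    filter_upwards [eventually_lt_of_norm_lt
      (lt_add_of_pos_right ‖x‖ (div_pos hε hc))] with n hn
    rw [smul_apply, norm_smul]
    have h1 : ‖c‖ * (ε / (‖c‖ + 1)) ≤ ε := by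
      rw [← mul_div_assoc, div_le_iff₀ hc]
      nlinarith [norm_nonneg c]
    nlinarith [norm_nonneg c, mul_le_mul_of_nonneg_left hn.le (norm_nonneg c)]

theorem norm_star (x : BoundedSeq B) : ‖star x‖ = ‖x‖ :=
  norm_congr (Eventually.of_forall fun n => by rw [star_apply, _root_.norm_star])

theorem norm_mul_self_le (x : BoundedSeq B) : ‖x‖ * ‖x‖ ≤ ‖star x * x‖ := by
  -- Any c above the limsup of ‖x n‖² bounds it eventually, so √c eventually bounds ‖x n‖.
  refine le_of_forall_gt_imp_ge_of_dense fun c hc => ?_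
  have hc0 : 0 ≤ c := (norm_nonneg _).trans hc.le
  have h : ‖x‖ ≤ √c := norm_le_of_eventually <| by
    filter_upwards [eventually_lt_of_norm_lt hc] with n hn
    rw [mul_apply, star_apply, CStarRing.norm_star_mul_self] at hn
    exact Real.le_sqrt_of_sq_le (by rw [sq]; exact hn.le)
  calc ‖x‖ * ‖x‖ ≤ √c * √c := mul_le_mul h h (norm_nonneg _) (Real.sqrt_nonneg _)
    _ = c := Real.mul_self_sqrt hc0

end BoundedSeq

/-- The C*-algebra `ℓ^∞(B) / c₀(B)`. -/
def SeqAlgebra (B : Type u) [CStarAlgebra B] : Type u := Completion (BoundedSeq B)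

namespace SeqAlgebra

variable {B : Type u} [CStarAlgebra B]

noncomputable instance : NormedRing (SeqAlgebra B) :=
  inferInstanceAs (NormedRing (Completion (BoundedSeq B)))

instance : CompleteSpace (SeqAlgebra B) :=
  inferInstanceAs (CompleteSpace (Completion (BoundedSeq B)))

noncomputable instance : Algebra ℂ (SeqAlgebra B) :=
  inferInstanceAs (Algebra ℂ (Completion (BoundedSeq B)))

noncomputable instance : NormedAlgebra ℂ (SeqAlgebra B) where
  norm_smul_le := (inferInstance : NormedSpace ℂ (Completion (BoundedSeq B))).norm_smul_le

theorem isometry_star : Isometry (star : BoundedSeq B → BoundedSeq B) :=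
  AddMonoidHomClass.isometry_of_norm (starAddEquiv : BoundedSeq B ≃+ BoundedSeq B)
    BoundedSeq.norm_star

noncomputable instance : Star (SeqAlgebra B) where
  star := Completion.map (star : BoundedSeq B → BoundedSeq B)

theorem continuous_star : Continuous (star : SeqAlgebra B → SeqAlgebra B) :=
  Completion.continuous_map

/-- The class of a bounded sequence. -/
noncomputable def ofSeq (x : BoundedSeq B) : SeqAlgebra B :=
  (Completion.coe' x : Completion (BoundedSeq B))

theorem norm_ofSeq (x : BoundedSeq B) : ‖ofSeq x‖ = ‖x‖ := Completion.norm_coe x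

theorem star_ofSeq (x : BoundedSeq B) : star (ofSeq x) = ofSeq (star x) :=
  Completion.map_coe isometry_star.uniformContinuous x

theorem ofSeq_add (x y : BoundedSeq B) : ofSeq (x + y) = ofSeq x + ofSeq y :=
  Completion.coe_add x y

theorem ofSeq_mul (x y : BoundedSeq B) : ofSeq (x * y) = ofSeq x * ofSeq y :=
  Completion.coe_mul x y

theorem ofSeq_smul (c : ℂ) (x : BoundedSeq B) : ofSeq (c • x) = c • ofSeq x :=
  Completion.coe_smul c x

theorem denseRange_ofSeq : DenseRange (ofSeq : BoundedSeq B → SeqAlgebra B) :=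
  Completion.denseRange_coe

noncomputable instance : StarRing (SeqAlgebra B) where
  star_involutive x := congrFun (denseRange_ofSeq.equalizer
    (continuous_star.comp continuous_star) continuous_id
    (by ext x; simp [star_ofSeq])) x
  star_mul x y := by
    refine denseRange_ofSeq.induction_on₂ (p := fun x y => star (x * y) = star y * star x)
      (isClosed_eq (continuous_star.comp continuous_mul)
        ((continuous_star.comp continuous_snd).mul (continuous_star.comp continuous_fst)))
      (fun x y => ?_) x y
    rw [← ofSeq_mul, star_ofSeq, star_ofSeq, star_ofSeq, star_mul, ofSeq_mul]
  star_add x y := by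
    refine denseRange_ofSeq.induction_on₂ (p := fun x y => star (x + y) = star x + star y)
      (isClosed_eq (continuous_star.comp continuous_add)
        ((continuous_star.comp continuous_fst).add (continuous_star.comp continuous_snd)))
      (fun x y => ?_) x y
    rw [← ofSeq_add, star_ofSeq, star_ofSeq, star_ofSeq, star_add, ofSeq_add]

noncomputable instance : CStarAlgebra (SeqAlgebra B) where
  norm_mul_self_le x := by
    refine denseRange_ofSeq.induction_on (p := fun x : SeqAlgebra B => ‖x‖ * ‖x‖ ≤ ‖star x * x‖)
      x (isClosed_le (continuous_norm.mul continuous_norm)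
        (continuous_norm.comp (continuous_star.mul continuous_id))) fun x => ?_
    rw [star_ofSeq, ← ofSeq_mul, norm_ofSeq, norm_ofSeq]
    exact BoundedSeq.norm_mul_self_le x
  star_smul c x := by
    refine denseRange_ofSeq.induction_on
      (p := fun x : SeqAlgebra B => star (c • x) = star c • star x)
      x (isClosed_eq (continuous_star.comp (continuous_const_smul c))
        (continuous_star.const_smul (star c))) fun x => ?_
    rw [← ofSeq_smul, star_ofSeq, star_ofSeq, ← ofSeq_smul, star_smul]

variable (B) in
/-- The quotient map `ℓ^∞(B) → ℓ^∞(B) / c₀(B)`. -/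
noncomputable def quot : BoundedSeq B →⋆ₐ[ℂ] SeqAlgebra B where
  toFun := ofSeq
  map_one' := Completion.coe_one _
  map_mul' := ofSeq_mul
  map_zero' := Completion.coe_zero
  map_add' := ofSeq_add
  commutes' c := by
    rw [Algebra.algebraMap_eq_smul_one, Algebra.algebraMap_eq_smul_one, ofSeq_smul]
    congr 1
  map_star' x := (star_ofSeq x).symm

theorem norm_quot (x : BoundedSeq B) : ‖quot B x‖ = ‖x‖ := norm_ofSeq x

/-- Density is enough in the sequel: an element of the quotient is only ever replaced by a bounded
sequence in order to verify a closed condition, extend a contraction, or preserve an open condition.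
-/
theorem denseRange_quot : DenseRange (quot B) := denseRange_ofSeq

theorem norm_quot_le_of_eventually {x : BoundedSeq B} {c : ℝ} (h : ∀ᶠ n in atTop, ‖x n‖ ≤ c) :
    ‖quot B x‖ ≤ c :=
  (norm_quot x).le.trans (BoundedSeq.norm_le_of_eventually h)

theorem eventually_lt_of_norm_quot_lt {x : BoundedSeq B} {c : ℝ} (h : ‖quot B x‖ < c) :
    ∀ᶠ n in atTop, ‖x n‖ < c :=
  BoundedSeq.eventually_lt_of_norm_lt ((norm_quot x).ge.trans_lt h)

end SeqAlgebra

namespace BoundedSeq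

variable {B B' : Type u} [CStarAlgebra B] [CStarAlgebra B']

variable (B) in
/-- Constant sequences. -/
noncomputable def const : B →⋆ₐ[ℂ] BoundedSeq B where
  toFun b := mk (fun _ => b) ‖b‖ fun _ => le_rfl
  map_one' := rfl
  map_mul' _ _ := rfl
  map_zero' := rfl
  map_add' _ _ := rfl
  commutes' _ := rfl
  map_star' _ := rfl

theorem const_apply (b : B) (n : ℕ) : const B b n = b := rfl

/-- Apply a unital `*`-homomorphism to all terms of a bounded sequence. -/
noncomputable def map (φ : B →⋆ₐ[ℂ] B') : BoundedSeq B →⋆ₐ[ℂ] BoundedSeq B' where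
  toFun x := mk (fun n => φ (x n)) x.exists_bound.choose fun n =>
    (NonUnitalStarAlgHom.norm_apply_le φ _).trans (x.exists_bound.choose_spec n)
  map_one' := ext fun _ => map_one φ
  map_mul' x y := ext fun n => map_mul φ (x n) (y n)
  map_zero' := ext fun _ => map_zero φ
  map_add' x y := ext fun n => map_add φ (x n) (y n)
  commutes' c := ext fun _ => AlgHomClass.commutes φ c
  map_star' x := ext fun n => map_star φ (x n)

theorem norm_map_le (φ : B →⋆ₐ[ℂ] B') (x : BoundedSeq B) : ‖map φ x‖ ≤ ‖x‖ := by
  refine le_of_forall_pos_le_add fun ε hε => norm_le_of_eventually ?_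
  filter_upwards [eventually_lt_of_norm_lt (lt_add_of_pos_right ‖x‖ hε)] with n hn
  exact (NonUnitalStarAlgHom.norm_apply_le φ _).trans hn.le

end BoundedSeq

namespace SeqAlgebra

variable {B B' : Type u} [CStarAlgebra B] [CStarAlgebra B']

variable (B) in
/-- The diagonal embedding. -/
noncomputable def diag : B →⋆ₐ[ℂ] SeqAlgebra B := (quot B).comp (BoundedSeq.const B)

theorem diag_apply (b : B) : diag B b = quot B (BoundedSeq.const B b) := rfl

/-- Functoriality of `ℓ^∞(B) / c₀(B)`. -/
theorem exists_map (φ : B →⋆ₐ[ℂ] B') : ∃ j : SeqAlgebra B →⋆ₐ[ℂ] SeqAlgebra B',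
    ∀ x, j (quot B x) = quot B' (BoundedSeq.map φ x) :=
  StarAlgHom.exists_extension (quot B) ((quot B').comp (BoundedSeq.map φ)) denseRange_quot
    fun x => by
      rw [norm_quot]
      exact (norm_quot _).le.trans (BoundedSeq.norm_map_le φ x)

end SeqAlgebra

/-! ### Approximate unitaries, pointwise limits and one-sided intertwining. -/

/-- Every approximately unitary element of a C*-algebra is close to a unitary. -/
theorem exists_unitary_norm_sub_le {B : Type*} [CStarAlgebra B] {x : B} {δ : ℝ} (hδ : δ ≤ 1 / 2)
    (h₁ : ‖star x * x - 1‖ ≤ δ) (h₂ : ‖x * star x - 1‖ ≤ δ) :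
    ∃ w : unitary B, ‖(w : B) - x‖ ≤ 2 * δ := by
  have hδ0 : 0 ≤ δ := (norm_nonneg _).trans h₁
  set a := star x * x with ha
  have hsa : IsSelfAdjoint a := IsSelfAdjoint.star_mul_self x
  have hspec : ∀ t ∈ spectrum ℝ a, |t - 1| ≤ δ := fun t ht => by
    have h := norm_apply_le_norm_cfc (fun t : ℝ => t - 1) a ht
    have e : cfc (fun t : ℝ => t - 1) a = a - 1 := by
      rw [cfc_sub (fun t : ℝ => t) (fun _ => 1) a, cfc_id' ℝ a, cfc_const_one ℝ a]
    rw [e] at h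
    exact h.trans h₁
  have hpos : ∀ t ∈ spectrum ℝ a, 1 / 2 ≤ t := fun t ht => by
    have := (abs_le.mp (hspec t ht)).1
    linarith
  have hcont : ContinuousOn (fun t : ℝ => (√t)⁻¹) (spectrum ℝ a) := by
    refine ContinuousOn.inv₀ (Real.continuous_sqrt.continuousOn) fun t ht => ?_
    exact (Real.sqrt_pos.mpr (by linarith [hpos t ht])).ne'
  -- Polar decomposition: h = (x*x)^(-1/2), and x * h will be the unitary.
  set h := cfc (fun t : ℝ => (√t)⁻¹) a with hh
  have hhs : star h = h := (cfc_predicate (fun t : ℝ => (√t)⁻¹) a : IsSelfAdjoint h)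
  have hah : h * a * h = 1 := by
    have e : h * a * h = cfc (fun t : ℝ => (√t)⁻¹ * t * (√t)⁻¹) a := by
      rw [cfc_mul (fun t : ℝ => (√t)⁻¹ * t) (fun t : ℝ => (√t)⁻¹) a
        (hcont.mul continuousOn_id) hcont, cfc_mul (fun t : ℝ => (√t)⁻¹) (fun t : ℝ => t) a
        hcont continuousOn_id, cfc_id' ℝ a]
    rw [e, ← cfc_const_one ℝ a]
    refine cfc_congr fun t ht => ?_
    have ht0 : 0 < t := by linarith [hpos t ht]
    have hs : √t * √t = t := Real.mul_self_sqrt ht0.le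
    have hs0 : √t ≠ 0 := (Real.sqrt_pos.mpr ht0).ne'
    change (√t)⁻¹ * t * (√t)⁻¹ = 1
    field_simp
    rw [sq, hs]
  have hh1 : ‖h - 1‖ ≤ δ := by
    have e : h - 1 = cfc (fun t : ℝ => (√t)⁻¹ - 1) a := by
      rw [cfc_sub (fun t : ℝ => (√t)⁻¹) (fun _ => 1) a hcont, cfc_const_one ℝ a]
    rw [e]
    refine norm_cfc_le hδ0 fun t ht => ?_
    have ht2 := hpos t ht
    have hs : √t * √t = t := Real.mul_self_sqrt (by linarith)
    have hs2 : 1 / 2 ≤ √t := by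
      refine Real.le_sqrt_of_sq_le ?_
      norm_num
      linarith
    have hs0 : 0 < √t := by linarith
    have h1 := abs_le.mp (hspec t ht)
    rw [Real.norm_eq_abs, abs_le]
    have e2 : (√t)⁻¹ - 1 = (1 - √t) / √t := by field_simp
    rw [e2, le_div_iff₀ hs0, div_le_iff₀ hs0]
    -- Since |1 - √t| = |1 - t| / (1 + √t), the bound by δ√t comes down to √t + t ≥ 1, and both
    -- summands are at least 1/2.
    constructor <;> nlinarith
  have hxx : ‖x‖ ≤ 2 := by
    have h1 : ‖a‖ ≤ δ + 1 := by
      rcases subsingleton_or_nontrivial B with _ | _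
      · rw [Subsingleton.elim a 0, norm_zero]
        linarith
      · have := norm_add_le (a - 1) 1
        rw [sub_add_cancel, CStarRing.norm_one] at this
        linarith
    rw [ha, CStarRing.norm_star_mul_self] at h1
    nlinarith [norm_nonneg x]
  have hu : star (x * h) * (x * h) = 1 := by
    rw [star_mul, hhs, mul_assoc, ← mul_assoc (star x), ← ha, ← mul_assoc, hah]
  -- So far x * h is only an isometry. Invertibility of x x*, from the second hypothesis, and of h
  -- supplies a right inverse.
  have hunit : IsUnit (x * h) := by
    have hx : IsUnit (x * star x) := by
      have := isUnit_one_sub_of_norm_lt_one (x := 1 - x * star x)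
        (by rw [norm_sub_rev]; linarith)
      rwa [sub_sub_cancel] at this
    have hr : ∃ y, (x * h) * y = 1 := by
      have hhu : IsUnit h := by
        have := isUnit_one_sub_of_norm_lt_one (x := 1 - h) (by rw [norm_sub_rev]; linarith)
        rwa [sub_sub_cancel] at this
      obtain ⟨y, hy⟩ := hhu.exists_right_inv
      obtain ⟨z, hz⟩ := hx.exists_right_inv
      exact ⟨y * (star x * z), by rw [mul_assoc, ← mul_assoc h, hy, one_mul, ← mul_assoc, hz]⟩
    obtain ⟨y, hy⟩ := hr
    exact ⟨⟨x * h, star (x * h), by rw [left_inv_eq_right_inv hu hy, hy], hu⟩, rfl⟩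
  have hu' : (x * h) * star (x * h) = 1 := by
    obtain ⟨y, hy⟩ := hunit.exists_right_inv
    rw [left_inv_eq_right_inv hu hy, hy]
  refine ⟨⟨x * h, Unitary.mem_iff.mpr ⟨hu, hu'⟩⟩, ?_⟩
  calc ‖x * h - x‖ = ‖x * (h - 1)‖ := by rw [mul_sub, mul_one]
    _ ≤ ‖x‖ * ‖h - 1‖ := norm_mul_le _ _
    _ ≤ 2 * δ := mul_le_mul hxx hh1 (norm_nonneg _) zero_le_two

/-- A pointwise limit of unital `*`-homomorphisms is a unital `*`-homomorphism. -/
theorem StarAlgHom.exists_tendsto {A B : Type*} [CStarAlgebra A] [CStarAlgebra B]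
    (α : ℕ → A →⋆ₐ[ℂ] B) (h : ∀ a, CauchySeq fun n => α n a) :
    ∃ Ψ : A →⋆ₐ[ℂ] B, ∀ a, Tendsto (fun n => α n a) atTop (𝓝 (Ψ a)) := by
  choose Ψ hΨ using fun a => cauchySeq_tendsto_of_complete (h a)
  refine ⟨
    { toFun := Ψ
      map_one' := tendsto_nhds_unique (hΨ 1) (by simp only [map_one]; exact tendsto_const_nhds)
      map_zero' := tendsto_nhds_unique (hΨ 0) (by simp only [map_zero]; exact tendsto_const_nhds)
      map_mul' := fun x y => tendsto_nhds_unique (hΨ _)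
        (by simp only [map_mul]; exact (hΨ x).mul (hΨ y))
      map_add' := fun x y => tendsto_nhds_unique (hΨ _)
        (by simp only [map_add]; exact (hΨ x).add (hΨ y))
      commutes' := fun c => tendsto_nhds_unique (hΨ _)
        (by simp only [AlgHomClass.commutes]; exact tendsto_const_nhds)
      map_star' := fun x => tendsto_nhds_unique (hΨ _)
        (by simp only [map_star]; exact (hΨ x).star) }, hΨ⟩

/-- One-sided approximate intertwining by unitaries. -/
theorem StarAlgHom.exists_approxUnitarilyEquivalent_of_intertwining {A B : Type*} [CStarAlgebra A]
    [CStarAlgebra B] [TopologicalSpace.SeparableSpace A] (φ : A →⋆ₐ[ℂ] B) (hφ : ∀ a, ‖φ a‖ = ‖a‖)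
    (b : ℕ → B)
    (h : ∀ (F : Finset A) (G : Finset B) (ε : ℝ), 0 < ε → ∃ v : unitary B,
      (∀ a ∈ F, ‖(v : B) * φ a - φ a * v‖ < ε) ∧
        ∀ y ∈ G, ∃ a, ‖star (v : B) * y * v - φ a‖ < ε) :
    ∃ Ψ : A →⋆ₐ[ℂ] B, (∀ a, ‖Ψ a‖ = ‖a‖) ∧ ApproxUnitarilyEquivalent Ψ φ ∧
      ∀ k, b k ∈ Set.range Ψ := by
  classical
  set d := TopologicalSpace.denseSeq A with hd
  -- The state is the product u of the unitaries used so far and a finite set that later unitaries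
  -- must almost commute with. Apply the hypothesis to the conjugates u* b_k u for k ≤ n, and put
  -- the resulting preimages into the finite set so that later steps hardly move them.
  have hstep : ∀ (n : ℕ) (s : unitary B × Finset A), ∃ s' : unitary B × Finset A,
      (∃ v : unitary B, s'.1 = s.1 * v ∧
        ∀ a ∈ s.2, ‖(v : B) * φ a - φ a * v‖ < (1 / 2) ^ n) ∧ s.2 ⊆ s'.2 ∧ d n ∈ s'.2 ∧
      ∀ k ≤ n, ∃ a ∈ s'.2, ‖star (s'.1 : B) * b k * s'.1 - φ a‖ < (1 / 2) ^ n := by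
    intro n s
    obtain ⟨v, hv, hv'⟩ := h s.2
      ((Finset.range (n + 1)).image fun k => star (s.1 : B) * b k * s.1) ((1 / 2) ^ n)
      (by positivity)
    have hv'' : ∀ k : ℕ, ∃ a, k ≤ n →
        ‖star (v : B) * (star (s.1 : B) * b k * s.1) * v - φ a‖ < (1 / 2) ^ n := fun k => by
      by_cases hk : k ≤ n
      · obtain ⟨a, ha⟩ := hv' _ (Finset.mem_image_of_mem _ (Finset.mem_range_succ_iff.mpr hk))
        exact ⟨a, fun _ => ha⟩
      · exact ⟨0, fun h => absurd h hk⟩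
    choose a ha using hv''
    refine ⟨(s.1 * v, s.2 ∪ {d n} ∪ (Finset.range (n + 1)).image a), ⟨v, rfl, hv⟩, ?_, ?_, ?_⟩
    · intro x hx
      simp [hx]
    · simp
    · intro k hk
      refine ⟨a k, ?_, ?_⟩
      · exact Finset.mem_union_right _
          (Finset.mem_image_of_mem _ (Finset.mem_range_succ_iff.mpr hk))
      · have := ha k hk
        simpa only [Submonoid.coe_mul, star_mul, mul_assoc] using this
  choose step hstep₁ hstep₂ hstep₃ hstep₄ using hstep
  let s : ℕ → unitary B × Finset A := fun n => Nat.rec (1, ∅) (fun n s => step n s) n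
  have hs : ∀ n, s (n + 1) = step n (s n) := fun n => rfl
  have hmono : Monotone fun n => (s n).2 := monotone_nat_of_le_succ fun n => hstep₂ n (s n)
  let α : ℕ → A →⋆ₐ[ℂ] B := fun n =>
    (Unitary.conjStarAlgAut ℂ B (s n).1 : B →⋆ₐ[ℂ] B).comp φ
  have hα : ∀ n a, α n a = (s n).1 * φ a * star ((s n).1 : B) := fun n a => rfl
  have hnorm : ∀ n a, ‖α n a‖ = ‖a‖ := fun n a => by
    rw [hα, ← Unitary.coe_star, CStarRing.norm_mul_coe_unitary, CStarRing.norm_coe_unitary_mul, hφ]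
  have hconj : ∀ n (y z : B), ‖y - (s n).1 * z * star ((s n).1 : B)‖
      = ‖star ((s n).1 : B) * y * (s n).1 - z‖ := fun n y z => by
    rw [← CStarRing.norm_coe_unitary_mul (star (s n).1), ← CStarRing.norm_mul_coe_unitary _ (s n).1]
    congr 1
    rw [mul_sub, sub_mul, Unitary.coe_star]
    congr 1
    rw [← mul_assoc, ← mul_assoc, Unitary.coe_star_mul_self, one_mul, mul_assoc,
      Unitary.coe_star_mul_self, mul_one]
  -- Passing from u to uv changes u φ(a) u* by exactly the norm of the commutator of v and φ(a).
  have hdist : ∀ n, ∀ a ∈ (s n).2, dist (α n a) (α (n + 1) a) ≤ (1 / 2) ^ n := fun n a ha => by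
    obtain ⟨v, hv, hva⟩ := hstep₁ n (s n)
    rw [← hs] at hv
    have e : α n a - α (n + 1) a
        = (s n).1 * ((φ a * v - v * φ a) * (star v : unitary B)) * (star (s n).1 : unitary B) := by
      rw [hα n a, hα (n + 1) a, hv, sub_mul, mul_sub, sub_mul]
      simp only [Submonoid.coe_mul, star_mul, mul_assoc, Unitary.coe_star]
      rw [← mul_assoc (v : B) (star (v : B)), Unitary.mul_star_self_of_mem v.2, one_mul]
    rw [dist_eq_norm, e, CStarRing.norm_mul_coe_unitary, CStarRing.norm_coe_unitary_mul,
      CStarRing.norm_mul_coe_unitary, norm_sub_rev]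
    exact (hva a ha).le
  have hdist' : ∀ N, ∀ a ∈ (s N).2, ∀ k,
      dist (α (k + N) a) (α (k + 1 + N) a) ≤ (1 / 2) ^ N * (1 / 2) ^ k := fun N a ha k => by
    have := hdist (k + N) a (hmono (Nat.le_add_left N k) ha)
    rw [pow_add, mul_comm] at this
    rwa [Nat.add_right_comm]
  have hcauchyF : ∀ N, ∀ a ∈ (s N).2, CauchySeq fun n => α n a := fun N a ha =>
    (cauchySeq_shift (u := fun n => α n a) N).mp
      (cauchySeq_of_le_geometric _ _ (by norm_num) (hdist' N a ha))
  have hcauchy : ∀ a, CauchySeq fun n => α n a := fun a => by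
    rw [Metric.cauchySeq_iff']
    intro ε hε
    -- The geometric estimate covers only the tracked elements. They include the dense sequence, and
    -- all `α n` are isometric, so convergence spreads to every a.
    obtain ⟨i, hi⟩ := Metric.denseRange_iff.mp (TopologicalSpace.denseRange_denseSeq A) a (ε / 3)
      (by positivity)
    obtain ⟨N, hN⟩ := Metric.cauchySeq_iff'.mp (hcauchyF (i + 1) (d i) (hstep₃ i (s i))) (ε / 3)
      (by positivity)
    refine ⟨N, fun n hn => ?_⟩
    have h1 : ∀ m, dist (α m a) (α m (d i)) < ε / 3 := fun m => by
      rwa [dist_eq_norm, ← map_sub, hnorm, ← dist_eq_norm]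
    have h2 := h1 N
    rw [dist_comm] at h2
    linarith [dist_triangle4 (α n a) (α n (d i)) (α N (d i)) (α N a), h1 n, hN n hn]
  obtain ⟨Ψ, hΨ⟩ := StarAlgHom.exists_tendsto α hcauchy
  have hΨn : ∀ a, ‖Ψ a‖ = ‖a‖ := fun a =>
    tendsto_nhds_unique (hΨ a).norm (by simp only [hnorm]; exact tendsto_const_nhds)
  refine ⟨Ψ, hΨn, ⟨fun n => (s n).1, fun a => ?_⟩, fun k => ?_⟩
  · have h1 := tendsto_iff_norm_sub_tendsto_zero.mp (hΨ a)
    refine h1.congr fun n => ?_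
    rw [← hconj, norm_sub_rev, hα]
  -- The range of an isometry on a complete space is closed, so approximating b_k suffices. It lies
  -- within 2^(-n) of `α (n + 1) a` for a tracked a, and the tail of the geometric series moves that
  -- by at most another 2^(-n).
  · have hclosed : IsClosed (Set.range Ψ) :=
      (AddMonoidHomClass.isometry_of_norm Ψ hΨn).isClosedEmbedding.isClosed_range
    rw [← hclosed.closure_eq, Metric.mem_closure_iff]
    intro ε hε
    obtain ⟨N, hN⟩ := exists_pow_lt_of_lt_one (half_pos hε) (by norm_num : (1 / 2 : ℝ) < 1)
    set n := max N k with hn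
    have hn2 : (1 / 2 : ℝ) ^ n < ε / 2 :=
      (pow_le_pow_of_le_one (by norm_num) (by norm_num) (le_max_left N k)).trans_lt hN
    obtain ⟨a, ha, hab⟩ := hstep₄ n (s n) k (le_max_right N k)
    rw [← hs] at ha hab
    rw [← hconj (n + 1), ← hα (n + 1), ← dist_eq_norm] at hab
    refine ⟨Ψ a, ⟨a, rfl⟩, ?_⟩
    have h1 : dist (α (0 + (n + 1)) a) (Ψ a) ≤ (1 / 2) ^ (n + 1) / (1 - 1 / 2) :=
      dist_le_of_le_geometric_of_tendsto₀ _ _ (by norm_num) (hdist' (n + 1) a ha)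
        ((tendsto_add_atTop_iff_nat (n + 1)).mpr (hΨ a))
    have h2 : (1 / 2 : ℝ) ^ (n + 1) / (1 - 1 / 2) = (1 / 2) ^ n := by ring
    rw [zero_add, h2] at h1
    linarith [dist_triangle (b k) (α (n + 1) a) (Ψ a)]

/-! ### Commuting homomorphisms and the spatial norm. -/

namespace AlgTensor

variable {A B E : Type u} [CStarAlgebra A] [CStarAlgebra B] [CStarAlgebra E]

/-- Commuting unital `*`-homomorphisms induce one on the algebraic tensor product. -/
noncomputable def lift (π₁ : A →⋆ₐ[ℂ] E) (π₂ : B →⋆ₐ[ℂ] E) (h : ∀ a b, Commute (π₁ a) (π₂ b)) :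
    AlgTensor A B →⋆ₐ[ℂ] E where
  __ := (Algebra.TensorProduct.lift π₁.toAlgHom π₂.toAlgHom h : A ⊗[ℂ] B →ₐ[ℂ] E)
  map_star' x := by
    change Algebra.TensorProduct.lift π₁.toAlgHom π₂.toAlgHom h (star (x : A ⊗[ℂ] B))
      = star (Algebra.TensorProduct.lift π₁.toAlgHom π₂.toAlgHom h (x : A ⊗[ℂ] B))
    change A ⊗[ℂ] B at x
    induction x with
    | zero => simp
    | add x y hx hy => simp only [star_add, map_add, hx, hy]
    | tmul a b =>
      change π₁ (star a) * π₂ (star b) = star (π₁ a * π₂ b)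
      rw [map_star, map_star, star_mul, (h a b).star_star.eq]

theorem lift_tmul (π₁ : A →⋆ₐ[ℂ] E) (π₂ : B →⋆ₐ[ℂ] E) (h : ∀ a b, Commute (π₁ a) (π₂ b))
    (a : A) (b : B) : lift π₁ π₂ h (a ⊗ₜ[ℂ] b : A ⊗[ℂ] B) = π₁ a * π₂ b := rfl

end AlgTensor

/-- `w ↦ φ(w)` on unitaries. -/
theorem StarAlgHom.exists_unitary_map {B B' : Type*} [CStarAlgebra B] [CStarAlgebra B']
    (φ : B →⋆ₐ[ℂ] B') (w : unitary B) : ∃ w' : unitary B', (w' : B') = φ w :=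
  ⟨⟨φ w, Unitary.mem_iff.mpr ⟨by rw [← map_star, ← map_mul, Unitary.star_mul_self_of_mem w.2, map_one],
    by rw [← map_star, ← map_mul, Unitary.mul_star_self_of_mem w.2, map_one]⟩⟩, rfl⟩

/-- If `D` has approximate inner half-flip, then any two commuting unital `*`-homomorphisms from `D`
to a C*-algebra induce a `*`-homomorphism on the minimal tensor product `D ⊗ D`. -/
theorem HasApproxInnerHalfFlip.exists_lift {D E : Type u} [CStarAlgebra D] [CStarAlgebra E]
    [Nontrivial D] (hD : HasApproxInnerHalfFlip D) (π₁ π₂ : D →⋆ₐ[ℂ] E)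
    (h : ∀ a b, Commute (π₁ a) (π₂ b)) :
    ∃ Λ : MinTensor D D →⋆ₐ[ℂ] E,
      (∀ a, Λ (MinTensor.inl D D a) = π₁ a) ∧ ∀ b, Λ (MinTensor.inr D D b) = π₂ b := by
  obtain ⟨w, hw⟩ := hD
  -- The half-flip unitaries are carried into E ⊗ D by π₂ ⊗ id, whose range commutes with π₁(a) ⊗ 1.
  choose V hV using fun n => (MinTensor.map π₂ (StarAlgHom.id ℂ D)).exists_unitary_map (w n)
  have hcomm : ∀ a y, Commute (MinTensor.inl E D (π₁ a))
      (MinTensor.map π₂ (StarAlgHom.id ℂ D) y) := fun a y => by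
    refine MinTensor.induction_closed (p := fun y => Commute (MinTensor.inl E D (π₁ a))
      (MinTensor.map π₂ (StarAlgHom.id ℂ D) y)) ?_ (fun x y hx hy => ?_) (fun c b => ?_) y
    · have hc : Continuous (MinTensor.map π₂ (StarAlgHom.id ℂ D)) :=
        MinTensor.continuous_mapFun _ _
      exact isClosed_eq (continuous_const.mul hc) (hc.mul continuous_const)
    · rw [map_add]
      exact hx.add_right hy
    · rw [map_mul, MinTensor.map_inl, MinTensor.map_inr]
      exact ((h a c).map (MinTensor.inl E D)).mul_right (MinTensor.commute_inl_inr _ _)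
  -- On a ⊗ b: conjugation by V_n fixes π₁(a) ⊗ 1, and it sends π₂(b) ⊗ 1 to the image of w_n*(b ⊗
  -- 1)w_n, which tends to 1 ⊗ b.
  have key : ∀ x : AlgTensor D D, Tendsto (fun n => star (V n : MinTensor E D)
      * MinTensor.inl E D (AlgTensor.lift π₁ π₂ h x) * V n) atTop
      (𝓝 (MinTensor.map π₁ (StarAlgHom.id ℂ D) (MinTensor.ofAlg x))) := fun x => by
    change D ⊗[ℂ] D at x
    induction x with
    | zero =>
      have h0 : MinTensor.ofAlg (0 : AlgTensor D D) = 0 := map_zero (MinTensor.ofAlgHom D D)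
      have h1 : AlgTensor.lift π₁ π₂ h 0 = 0 := map_zero _
      change Tendsto (fun n => star (V n : MinTensor E D)
        * MinTensor.inl E D (AlgTensor.lift π₁ π₂ h 0) * V n) atTop
        (𝓝 (MinTensor.map π₁ (StarAlgHom.id ℂ D) (MinTensor.ofAlg (0 : AlgTensor D D))))
      simp only [h0, h1, map_zero, mul_zero, zero_mul]
      exact tendsto_const_nhds
    | add x y hx hy =>
      have h0 : MinTensor.ofAlg (x + y : D ⊗[ℂ] D) = _ := MinTensor.ofAlg_add x y
      have h1 : AlgTensor.lift π₁ π₂ h (x + y : D ⊗[ℂ] D) = _ :=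
        map_add (AlgTensor.lift π₁ π₂ h) x y
      have := hx.add hy
      rw [← map_add, ← h0] at this
      refine this.congr fun n => ?_
      rw [h1, map_add, mul_add, add_mul]
      rfl
    | tmul a b =>
      have h0 : MinTensor.ofAlg (a ⊗ₜ b : D ⊗[ℂ] D) = _ := MinTensor.ofAlg_tmul a b
      have h2 := tendsto_iff_norm_sub_tendsto_zero.mpr (hw b)
      have hc : Continuous (MinTensor.map π₂ (StarAlgHom.id ℂ D)) :=
        MinTensor.continuous_mapFun _ _
      have h3 := (((hc.tendsto _).comp h2).const_mul (MinTensor.inl E D (π₁ a)))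
      have e : MinTensor.map π₁ (StarAlgHom.id ℂ D) (MinTensor.ofAlg (a ⊗ₜ b : D ⊗[ℂ] D))
          = MinTensor.inl E D (π₁ a)
            * MinTensor.map π₂ (StarAlgHom.id ℂ D) (MinTensor.inr D D b) := by
        rw [h0, map_mul, MinTensor.map_inl, MinTensor.map_inr, MinTensor.map_inr]
      rw [e]
      refine h3.congr fun n => ?_
      have hcs : Commute (MinTensor.inl E D (π₁ a)) (star (V n : MinTensor E D)) := by
        rw [hV, ← map_star]
        exact hcomm a _
      rw [AlgTensor.lift_tmul, map_mul, ← mul_assoc (star (V n : MinTensor E D)), ← hcs.eq,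
        Function.comp_apply, map_mul, map_mul, map_star, MinTensor.map_inl, ← hV]
      simp only [mul_assoc]
  -- Conjugation and the embedding of E are isometric, so the norm of the lift equals that of the
  -- limit (π₁ ⊗ id)(x), which is at most the spatial norm.
  have hle : ∀ x, ‖AlgTensor.lift π₁ π₂ h x‖ ≤ ‖MinTensor.ofAlgHom D D x‖ := fun x => by
    have h1 := (key x).norm
    have h2 : ∀ n, ‖star (V n : MinTensor E D)
        * MinTensor.inl E D (AlgTensor.lift π₁ π₂ h x) * V n‖ = ‖AlgTensor.lift π₁ π₂ h x‖ :=
      fun n => by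
        rw [CStarRing.norm_mul_coe_unitary, ← Unitary.coe_star, CStarRing.norm_coe_unitary_mul,
          MinTensor.norm_inl]
    simp only [h2] at h1
    rw [tendsto_nhds_unique tendsto_const_nhds h1]
    exact NonUnitalStarAlgHom.norm_apply_le (MinTensor.map π₁ (StarAlgHom.id ℂ D)) _
  obtain ⟨Λ, hΛ⟩ := StarAlgHom.exists_extension (MinTensor.ofAlgHom D D)
    (AlgTensor.lift π₁ π₂ h) MinTensor.denseRange_ofAlg hle
  refine ⟨Λ, fun a => (hΛ _).trans ?_, fun b => (hΛ _).trans ?_⟩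
  · exact (AlgTensor.lift_tmul π₁ π₂ h a 1).trans (by rw [map_one, mul_one])
  · exact (AlgTensor.lift_tmul π₁ π₂ h 1 b).trans (by rw [map_one, one_mul])

theorem StarAlgHom.continuous_of_cstar {P W : Type*} [CStarAlgebra P] [CStarAlgebra W]
    (φ : P →⋆ₐ[ℂ] W) : Continuous φ :=
  (AddMonoidHomClass.lipschitz_of_bound φ 1 fun x => by
    rw [one_mul]
    exact NonUnitalStarAlgHom.norm_apply_le φ x).continuous

/-- Pointwise convergence of `*`-homomorphisms holds on a closed set. -/
theorem StarAlgHom.isClosed_setOf_tendsto {P W : Type*} [CStarAlgebra P] [CStarAlgebra W]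
    (α : ℕ → P →⋆ₐ[ℂ] W) (β : P →⋆ₐ[ℂ] W) :
    IsClosed {y | Tendsto (fun n => α n y) atTop (𝓝 (β y))} := by
  refine isClosed_of_closure_subset fun y hy => ?_
  refine Metric.tendsto_atTop.mpr fun ε hε => ?_
  obtain ⟨z, hz, hyz⟩ := Metric.mem_closure_iff.mp hy (ε / 3) (by positivity)
  obtain ⟨N, hN⟩ := Metric.tendsto_atTop.mp hz (ε / 3) (by positivity)
  refine ⟨N, fun n hn => ?_⟩
  have hle : ∀ γ : P →⋆ₐ[ℂ] W, dist (γ y) (γ z) ≤ dist y z := fun γ => by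
    rw [dist_eq_norm, dist_eq_norm, ← map_sub]
    exact NonUnitalStarAlgHom.norm_apply_le γ _
  have h1 := hle β
  rw [dist_comm (β y)] at h1
  linarith [dist_triangle4 (α n y) (α n z) (β z) (β y), hle (α n), hN n hn]

/-- The unitary `w` moves `x` close to `y` iff `w*` moves `y` close to `x`. -/
theorem Unitary.norm_conj_sub {B : Type*} [CStarAlgebra B] (w : unitary B) (x y : B) :
    ‖(w : B) * y * star (w : B) - x‖ = ‖star (w : B) * x * w - y‖ := by
  rw [← CStarRing.norm_coe_unitary_mul (star w), ← CStarRing.norm_mul_coe_unitary _ w,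
    Unitary.coe_star, norm_sub_rev (star (w : B) * x * w)]
  congr 1
  rw [mul_sub, sub_mul]
  congr 1
  rw [← mul_assoc, ← mul_assoc, Unitary.star_mul_self_of_mem w.2, one_mul, mul_assoc,
    Unitary.star_mul_self_of_mem w.2, mul_one]

/-! ### From a central map and the half-flip to strong self-absorption. -/

/-- An asymptotically central `*`-homomorphism `θ : D → ℓ^∞(D) / c₀(D)` and the half-flip yield
unitaries in `ℓ^∞(D ⊗ D) / c₀(D ⊗ D)` that commute with `D ⊗ 1` and move `D ⊗ D` into the
sequences in `D ⊗ 1`. -/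
theorem HasApproxInnerHalfFlip.exists_unitary_seqAlgebra {D : Type u} [CStarAlgebra D]
    [Nontrivial D] (hD : HasApproxInnerHalfFlip D) (θ : D →⋆ₐ[ℂ] SeqAlgebra D)
    (hθ : ∀ a b, Commute (SeqAlgebra.diag D a) (θ b))
    {j : SeqAlgebra D →⋆ₐ[ℂ] SeqAlgebra (MinTensor D D)}
    (hj : ∀ x, j (SeqAlgebra.quot D x) =
      SeqAlgebra.quot _ (BoundedSeq.map (MinTensor.inl D D) x)) :
    ∃ (V : ℕ → unitary (SeqAlgebra (MinTensor D D))) (μ : MinTensor D D →⋆ₐ[ℂ] SeqAlgebra D),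
      (∀ n a, Commute (SeqAlgebra.diag _ (MinTensor.inl D D a)) (V n : SeqAlgebra (MinTensor D D))) ∧
      ∀ y, Tendsto (fun n => star (V n : SeqAlgebra (MinTensor D D)) * SeqAlgebra.diag _ y *
        (V n : SeqAlgebra (MinTensor D D))) atTop (𝓝 (j (μ y))) := by
  have hjdiag : ∀ a, j (SeqAlgebra.diag D a) = SeqAlgebra.diag _ (MinTensor.inl D D a) :=
    fun a => hj _
  have hjinr : ∀ z b, Commute (j z) (SeqAlgebra.diag _ (MinTensor.inr D D b)) := fun z b => by
    refine SeqAlgebra.denseRange_quot.induction_on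
      (p := fun z => Commute (j z) (SeqAlgebra.diag _ (MinTensor.inr D D b))) z ?_ fun x => ?_
    · have hc : Continuous j := j.continuous_of_cstar
      exact isClosed_eq (hc.mul continuous_const) (continuous_const.mul hc)
    · rw [hj, SeqAlgebra.diag_apply, Commute, SemiconjBy, ← map_mul, ← map_mul]
      congr 1
      exact BoundedSeq.ext fun n => (MinTensor.commute_inl_inr (x n) b).eq
  -- `μ` is a ⊗ b ↦ aθ(b), the intended limit of the conjugations; `Λ` is a ⊗ b ↦ j(θ(a))(1 ⊗ b),
  -- through which the half-flip is transported.
  obtain ⟨μ, hμl, hμr⟩ := hD.exists_lift (SeqAlgebra.diag D) θ hθ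
  obtain ⟨Λ, hΛl, hΛr⟩ := hD.exists_lift (j.comp θ)
    ((SeqAlgebra.diag (MinTensor D D)).comp (MinTensor.inr D D)) fun a b => hjinr (θ a) b
  have hΛcomm : ∀ a y, Commute (SeqAlgebra.diag _ (MinTensor.inl D D a)) (Λ y) := fun a y => by
    refine MinTensor.induction_closed
      (p := fun y => Commute (SeqAlgebra.diag _ (MinTensor.inl D D a)) (Λ y)) ?_
      (fun x y hx hy => ?_) (fun c b => ?_) y
    · have hc : Continuous Λ := Λ.continuous_of_cstar
      exact isClosed_eq (continuous_const.mul hc) (hc.mul continuous_const)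
    · rw [map_add]
      exact hx.add_right hy
    · rw [map_mul, hΛl, hΛr]
      refine Commute.mul_right ?_ ((MinTensor.commute_inl_inr a b).map (SeqAlgebra.diag _))
      rw [← hjdiag]
      exact (hθ a c).map j
  obtain ⟨w, hw⟩ := hD
  -- The adjoint appears because the flip is needed backwards: w_n(1 ⊗ b)w_n* → b ⊗ 1, and `Λ` turns
  -- this into V_n*(1 ⊗ b)V_n → j(θ(b)).
  choose V hV using fun n => Λ.exists_unitary_map (star (w n))
  have hVcomm : ∀ n a, Commute (SeqAlgebra.diag _ (MinTensor.inl D D a))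
      (V n : SeqAlgebra (MinTensor D D)) := fun n a => by
    rw [hV]
    exact hΛcomm a _
  refine ⟨V, μ, hVcomm, fun y => ?_⟩
  let α : ℕ → MinTensor D D →⋆ₐ[ℂ] SeqAlgebra (MinTensor D D) := fun n =>
    (Unitary.conjStarAlgAut ℂ _ (star (V n)) : _ →⋆ₐ[ℂ] SeqAlgebra (MinTensor D D)).comp
      (SeqAlgebra.diag _)
  have hα : ∀ n y, α n y = star (V n : SeqAlgebra (MinTensor D D)) * SeqAlgebra.diag _ y * V n :=
    fun n y => by
      change star (V n : SeqAlgebra (MinTensor D D)) * SeqAlgebra.diag _ y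
        * star (star (V n : SeqAlgebra (MinTensor D D))) = _
      rw [star_star]
  suffices h : Tendsto (fun n => α n y) atTop (𝓝 ((j.comp μ) y)) by
    exact h.congr fun n => hα n y
  refine MinTensor.induction_closed (p := fun y => Tendsto (fun n => α n y) atTop
    (𝓝 ((j.comp μ) y))) (StarAlgHom.isClosed_setOf_tendsto α (j.comp μ)) (fun x y hx hy => ?_)
    (fun a b => ?_) y
  · simp only [map_add]
    exact hx.add hy
  · simp only [map_mul]
    refine Tendsto.mul ?_ ?_
    · have h1 : ∀ n, α n (MinTensor.inl D D a) = (j.comp μ) (MinTensor.inl D D a) := fun n => by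
        rw [hα, mul_assoc, (hVcomm n a).eq, ← mul_assoc, Unitary.star_mul_self_of_mem (V n).2,
          one_mul, StarAlgHom.comp_apply, hμl, hjdiag]
      simp only [h1]
      exact tendsto_const_nhds
    · have h1 : ∀ n, α n (MinTensor.inr D D b)
          = Λ ((w n : MinTensor D D) * MinTensor.inr D D b * star (w n : MinTensor D D)) :=
        fun n => by
          rw [hα, map_mul, map_mul, hΛr, hV, Unitary.coe_star, ← map_star, star_star]
          rfl
      have h2 : Tendsto (fun n => (w n : MinTensor D D) * MinTensor.inr D D b
          * star (w n : MinTensor D D)) atTop (𝓝 (MinTensor.inl D D b)) := by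
        refine tendsto_iff_norm_sub_tendsto_zero.mpr ((hw b).congr fun n => ?_)
        rw [Unitary.norm_conj_sub]
      have h3 := (Λ.continuous_of_cstar.tendsto _).comp h2
      rw [hΛl] at h3
      simp only [h1]
      rw [StarAlgHom.comp_apply, hμr]
      exact h3

/-- An asymptotically central `*`-homomorphism `θ : D → ℓ^∞(D) / c₀(D)` and the half-flip yield
unitaries in `D ⊗ D` that almost commute with `D ⊗ 1` and move `D ⊗ D` almost into `D ⊗ 1`. -/
theorem HasApproxInnerHalfFlip.exists_unitary {D : Type u} [CStarAlgebra D]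
    [Nontrivial D] (hD : HasApproxInnerHalfFlip D) (θ : D →⋆ₐ[ℂ] SeqAlgebra D)
    (hθ : ∀ a b, Commute (SeqAlgebra.diag D a) (θ b)) (F : Finset D)
    (G : Finset (MinTensor D D)) {ε : ℝ} (hε : 0 < ε) :
    ∃ v : unitary (MinTensor D D),
      (∀ a ∈ F, ‖(v : MinTensor D D) * MinTensor.inl D D a - MinTensor.inl D D a * v‖ < ε) ∧
        ∀ y ∈ G, ∃ a, ‖star (v : MinTensor D D) * y * v - MinTensor.inl D D a‖ < ε := by
  obtain ⟨j, hj⟩ := SeqAlgebra.exists_map (MinTensor.inl D D)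
  obtain ⟨V, μ, hV, hVμ⟩ := hD.exists_unitary_seqAlgebra θ hθ hj
  have : Nontrivial (MinTensor D D) := (MinTensor.injective_inl (A := D) (B := D)).nontrivial
  -- A common norm bound for both finite sets; the summand 1 keeps it positive.
  set M : ℝ := 1 + ∑ a ∈ F, ‖a‖ + ∑ y ∈ G, ‖y‖ with hM
  have hMF : ∀ a ∈ F, ‖a‖ ≤ M := fun a ha => by
    have h1 := Finset.single_le_sum (f := fun a : D => ‖a‖) (fun a _ => norm_nonneg a) ha
    have h2 := Finset.sum_nonneg (s := G) fun y _ => norm_nonneg y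
    linarith
  have hMG : ∀ y ∈ G, ‖y‖ ≤ M := fun y hy => by
    have h1 := Finset.single_le_sum (f := fun y : MinTensor D D => ‖y‖)
      (fun y _ => norm_nonneg y) hy
    have h2 := Finset.sum_nonneg (s := F) fun a _ => norm_nonneg a
    linarith
  have hM0 : 0 < M := by
    have h1 := Finset.sum_nonneg (s := F) fun a _ => norm_nonneg a
    have h2 := Finset.sum_nonneg (s := G) fun y _ => norm_nonneg y
    linarith
  -- Replacing `x m` by a unitary at distance at most 2δ costs at most 4δM in the commutators and
  -- 6δM in the conjugates, hence at most ε/2; the bound 1/2 is what the polar decomposition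
  -- requires.
  set δ : ℝ := min (1 / 2) (ε / (12 * M)) with hδ
  have hδ0 : 0 < δ := by positivity
  have hδ2 : δ ≤ 1 / 2 := min_le_left _ _
  have hδM : 6 * δ * M ≤ ε / 2 := by
    have h1 : δ ≤ ε / (12 * M) := min_le_right _ _
    rw [le_div_iff₀ (by positivity)] at h1
    linarith
  have hz : ∀ y, ∃ z : BoundedSeq D, ‖j (μ y) - j (SeqAlgebra.quot D z)‖ < ε / 4 := fun y => by
    obtain ⟨z, hz⟩ := Metric.denseRange_iff.mp SeqAlgebra.denseRange_quot (μ y) (ε / 4)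
      (by positivity)
    refine ⟨z, ?_⟩
    rw [← map_sub]
    rw [dist_eq_norm] at hz
    exact (NonUnitalStarAlgHom.norm_apply_le j _).trans_lt hz
  choose z hz using hz
  have hn : ∀ᶠ n in atTop, ∀ y ∈ G,
      ‖star (V n : SeqAlgebra (MinTensor D D)) * SeqAlgebra.diag _ y * V n - j (μ y)‖ < ε / 4 :=
    (eventually_all_finset G).mpr fun y _ =>
      (tendsto_iff_norm_sub_tendsto_zero.mp (hVμ y)).eventually_lt_const (by positivity)
  obtain ⟨n, hn⟩ := hn.exists
  -- All four conditions are open and hold at V_n, hence at the class of some bounded sequence. As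
  -- the quotient norm is a limsup, they then hold for its terms eventually, all at one index m.
  have hopen : ∀ᶠ X in 𝓝 (V n : SeqAlgebra (MinTensor D D)),
      ‖star X * X - 1‖ < δ ∧ ‖X * star X - 1‖ < δ ∧
      (∀ a ∈ F, ‖X * SeqAlgebra.diag _ (MinTensor.inl D D a)
        - SeqAlgebra.diag _ (MinTensor.inl D D a) * X‖ < ε / 2) ∧
      ∀ y ∈ G, ‖star X * SeqAlgebra.diag _ y * X - j (SeqAlgebra.quot D (z y))‖ < ε / 2 := by
    refine Eventually.and ?_ (Eventually.and ?_ (Eventually.and ?_ ?_))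
    · refine ContinuousAt.eventually_lt (by fun_prop) continuousAt_const ?_
      rwa [Unitary.star_mul_self_of_mem (V n).2, sub_self, norm_zero]
    · refine ContinuousAt.eventually_lt (by fun_prop) continuousAt_const ?_
      rwa [Unitary.mul_star_self_of_mem (V n).2, sub_self, norm_zero]
    · refine (eventually_all_finset F).mpr fun a _ => ?_
      refine ContinuousAt.eventually_lt (by fun_prop) continuousAt_const ?_
      rw [(hV n a).eq, sub_self, norm_zero]
      positivity
    · refine (eventually_all_finset G).mpr fun y hy => ?_
      refine ContinuousAt.eventually_lt (by fun_prop) continuousAt_const ?_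
      have h1 := norm_sub_le_norm_sub_add_norm_sub
        (star (V n : SeqAlgebra (MinTensor D D)) * SeqAlgebra.diag _ y * V n) (j (μ y))
        (j (SeqAlgebra.quot D (z y)))
      linarith [hn y hy, hz y]
  obtain ⟨x, hX1, hX2, hX3, hX4⟩ := SeqAlgebra.denseRange_quot.mem_nhds hopen
  have e1 : ∀ᶠ m in atTop, ‖star (x m) * x m - 1‖ < δ := by
    rw [← map_star, ← map_mul, ← map_one (SeqAlgebra.quot (MinTensor D D)), ← map_sub] at hX1
    exact SeqAlgebra.eventually_lt_of_norm_quot_lt hX1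
  have e2 : ∀ᶠ m in atTop, ‖x m * star (x m) - 1‖ < δ := by
    rw [← map_star, ← map_mul, ← map_one (SeqAlgebra.quot (MinTensor D D)), ← map_sub] at hX2
    exact SeqAlgebra.eventually_lt_of_norm_quot_lt hX2
  have e3 : ∀ᶠ m in atTop, ∀ a ∈ F,
      ‖x m * MinTensor.inl D D a - MinTensor.inl D D a * x m‖ < ε / 2 :=
    (eventually_all_finset F).mpr fun a ha => by
      have h1 := hX3 a ha
      rw [SeqAlgebra.diag_apply, ← map_mul, ← map_mul, ← map_sub] at h1
      exact SeqAlgebra.eventually_lt_of_norm_quot_lt h1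
  have e4 : ∀ᶠ m in atTop, ∀ y ∈ G,
      ‖star (x m) * y * x m - MinTensor.inl D D (z y m)‖ < ε / 2 :=
    (eventually_all_finset G).mpr fun y hy => by
      have h1 := hX4 y hy
      rw [hj, SeqAlgebra.diag_apply, ← map_star, ← map_mul, ← map_mul, ← map_sub] at h1
      exact SeqAlgebra.eventually_lt_of_norm_quot_lt h1
  obtain ⟨m, h1, h2, h3, h4⟩ := (e1.and (e2.and (e3.and e4))).exists
  obtain ⟨v, hv⟩ := exists_unitary_norm_sub_le hδ2 h1.le h2.le
  have hv1 : ‖(v : MinTensor D D)‖ = 1 := CStarRing.norm_coe_unitary v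
  have hx2 : ‖x m‖ ≤ 2 := by
    have := norm_sub_norm_le (x m) (v : MinTensor D D)
    rw [norm_sub_rev] at this
    linarith
  refine ⟨v, fun a ha => ?_, fun y hy => ⟨z y m, ?_⟩⟩
  · have e : (v : MinTensor D D) * MinTensor.inl D D a - MinTensor.inl D D a * v
        = (x m * MinTensor.inl D D a - MinTensor.inl D D a * x m)
          + (((v : MinTensor D D) - x m) * MinTensor.inl D D a
            - MinTensor.inl D D a * ((v : MinTensor D D) - x m)) := by noncomm_ring
    have ha1 : ‖MinTensor.inl D D a‖ ≤ M := (MinTensor.norm_inl a).le.trans (hMF a ha)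
    have b1 : ‖((v : MinTensor D D) - x m) * MinTensor.inl D D a‖ ≤ 2 * δ * M :=
      (norm_mul_le _ _).trans (mul_le_mul hv ha1 (norm_nonneg _) (by positivity))
    have b2 : ‖MinTensor.inl D D a * ((v : MinTensor D D) - x m)‖ ≤ M * (2 * δ) :=
      (norm_mul_le _ _).trans (mul_le_mul ha1 hv (norm_nonneg _) hM0.le)
    rw [e]
    refine (norm_add_le _ _).trans_lt ?_
    have b3 := norm_sub_le (((v : MinTensor D D) - x m) * MinTensor.inl D D a)
      (MinTensor.inl D D a * ((v : MinTensor D D) - x m))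
    nlinarith [h3 a ha]
  · have e : star (v : MinTensor D D) * y * v - MinTensor.inl D D (z y m)
        = (star (x m) * y * x m - MinTensor.inl D D (z y m))
          + (star ((v : MinTensor D D) - x m) * y * v
            + star (x m) * y * ((v : MinTensor D D) - x m)) := by
      rw [star_sub]
      noncomm_ring
    have b1 : ‖star ((v : MinTensor D D) - x m) * y * v‖ ≤ 2 * δ * M := by
      rw [CStarRing.norm_mul_coe_unitary]
      refine (norm_mul_le _ _).trans (mul_le_mul ?_ (hMG y hy) (norm_nonneg _) (by positivity))
      rwa [norm_star]
    have b2 : ‖star (x m) * y * ((v : MinTensor D D) - x m)‖ ≤ 2 * M * (2 * δ) := by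
      refine (norm_mul_le _ _).trans (mul_le_mul ?_ hv (norm_nonneg _) (by positivity))
      refine (norm_mul_le _ _).trans (mul_le_mul ?_ (hMG y hy) (norm_nonneg _) zero_le_two)
      rwa [norm_star]
    rw [e]
    refine (norm_add_le _ _).trans_lt ?_
    have b3 := norm_add_le (star ((v : MinTensor D D) - x m) * y * v)
      (star (x m) * y * ((v : MinTensor D D) - x m))
    nlinarith [h4 y hy]

/-- A C*-algebra with approximate inner half-flip that admits an asymptotically central unital
`*`-endomorphism is strongly self-absorbing. -/
theorem HasApproxInnerHalfFlip.stronglySelfAbsorbing {D : Type u} [CStarAlgebra D]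
    [Nontrivial D] [TopologicalSpace.SeparableSpace D] (hD : HasApproxInnerHalfFlip D)
    (hne : ¬ Nonempty (D ≃⋆ₐ[ℂ] ℂ)) (θ : D →⋆ₐ[ℂ] SeqAlgebra D)
    (hθ : ∀ a b, Commute (SeqAlgebra.diag D a) (θ b)) : StronglySelfAbsorbing D := by
  set d := TopologicalSpace.denseSeq D with hd
  obtain ⟨Ψ, hΨn, hΨ, hb⟩ := StarAlgHom.exists_approxUnitarilyEquivalent_of_intertwining
    (MinTensor.inl D D) MinTensor.norm_inl
    -- Even and odd terms enumerate dense subsets of the two factors, so a closed `*`-subalgebra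
    -- containing all of them is D ⊗ D.
    (fun k => if Even k then MinTensor.inl D D (d (k / 2)) else MinTensor.inr D D (d (k / 2)))
    fun F G ε hε => hD.exists_unitary θ hθ F G hε
  have hiso : Isometry Ψ := AddMonoidHomClass.isometry_of_norm Ψ hΨn
  have hclosed : IsClosed (Ψ.range : Set (MinTensor D D)) :=
    hiso.isClosedEmbedding.isClosed_range
  have htop : Ψ.range = ⊤ := by
    refine MinTensor.starSubalgebra_eq_top hclosed (fun a => ?_) fun a => ?_
    · refine (TopologicalSpace.denseRange_denseSeq D).induction_on
        (p := fun a => MinTensor.inl D D a ∈ Ψ.range) a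
        (hclosed.preimage (MinTensor.inl D D).continuous_of_cstar) fun k => ?_
      have := hb (2 * k)
      rw [if_pos (even_two_mul k), Nat.mul_div_cancel_left _ two_pos] at this
      exact this
    · refine (TopologicalSpace.denseRange_denseSeq D).induction_on
        (p := fun a => MinTensor.inr D D a ∈ Ψ.range) a
        (hclosed.preimage (MinTensor.inr D D).continuous_of_cstar) fun k => ?_
      have := hb (2 * k + 1)
      rw [if_neg (by simp), Nat.mul_add_div two_pos] at this
      exact this
  have hsurj : Function.Surjective Ψ := fun y => by
    have : y ∈ Ψ.range := htop ▸ StarSubalgebra.mem_top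
    exact this
  exact ⟨inferInstance, hne, StarAlgEquiv.ofBijective Ψ ⟨hiso.injective, hsurj⟩, hΨ⟩

/-! ### Central maps from weak Fraïssé sequences and weak domination. -/

namespace CStarCategory

variable {ι : Type v} {A : ι → Type u} [∀ i, CStarAlgebra (A i)] {C K : CStarCategory A}

/-- The identity serves as ζ. -/
theorem Dominates.weaklyDominates (h : C.Dominates K) : C.WeaklyDominates K :=
  ⟨h.1, h.2.1, fun ε hε i hi F =>
    ⟨i, _, C.id_mem hi, fun j φ hφ => h.2.2 ε hε i hi j φ hφ F⟩⟩

theorem Sequence.IsFraisse.isWeakFraisse {S : C.Sequence} (h : S.IsFraisse) :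
    S.IsWeakFraisse := by
  refine ⟨h.1, fun ε hε n F => ⟨n, le_rfl, fun j γ hγ => ?_⟩⟩
  obtain ⟨m, hm, η, hη, hb⟩ := h.2 ε hε n F j γ hγ
  -- The Fraïssé property may return m = n, whereas the weak one asks for a strictly later stage;
  -- one more connecting map repairs this.
  refine ⟨m + 1, Nat.lt_succ_of_le hm, (S.map (Nat.le_succ m)).comp η,
    C.comp_mem (S.map_mem _) hη, fun a ha => ?_⟩
  have e : S.map (le_rfl.trans (Nat.lt_succ_of_le hm).le) a
      = S.map (Nat.le_succ m) (S.map hm a) := by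
    rw [← StarAlgHom.comp_apply, S.map_comp]
  rw [e, S.map_refl, StarAlgHom.comp_apply, ← map_sub]
  exact (NonUnitalStarAlgHom.norm_apply_le _ _).trans_lt (hb a ha)

theorem IsFraisseLimit.isWeakFraisseLimit {D : Type u} [CStarAlgebra D]
    (h : C.IsFraisseLimit D) : C.IsWeakFraisseLimit D := by
  obtain ⟨S, hS, hφ⟩ := h
  exact ⟨S, hS.isWeakFraisse, hφ⟩

namespace Sequence

variable {S : C.Sequence} {D : Type u} [CStarAlgebra D] {φ : ∀ n, A (S.obj n) →⋆ₐ[ℂ] D}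

theorem IsLimit.apply_map (hφ : S.IsLimit φ) {n m : ℕ} (h : n ≤ m) (a : A (S.obj n)) :
    φ m (S.map h a) = φ n a := by
  rw [← StarAlgHom.comp_apply, hφ.compatible]

theorem map_map {n m k : ℕ} (h : n ≤ m) (h' : m ≤ k) (a : A (S.obj n)) :
    S.map h' (S.map h a) = S.map (h.trans h') a := by
  rw [← StarAlgHom.comp_apply, S.map_comp]

theorem IsLimit.separableSpace [∀ i, TopologicalSpace.SeparableSpace (A i)] (hφ : S.IsLimit φ) :
    TopologicalSpace.SeparableSpace D := by
  refine TopologicalSpace.isSeparable_univ_iff.mp ?_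
  rw [← hφ.dense.closure_eq]
  exact (TopologicalSpace.IsSeparable.iUnion fun n =>
    TopologicalSpace.isSeparable_range (φ n).continuous_of_cstar).closure

theorem IsLimit.exists_norm_sub_lt (hφ : S.IsLimit φ) (n₀ : ℕ) (G : Finset D) {δ : ℝ}
    (hδ : 0 < δ) : ∃ n, n₀ ≤ n ∧ ∀ g ∈ G, ∃ a, ‖φ n a - g‖ < δ := by
  have h : ∀ g, ∃ n a, ‖φ n a - g‖ < δ := fun g => by
    obtain ⟨y, hy, hyg⟩ := Metric.dense_iff.mp hφ.dense g δ hδ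
    obtain ⟨n, a, rfl⟩ := Set.mem_iUnion.mp hyg
    exact ⟨n, a, by rwa [← dist_eq_norm]⟩
  choose N a ha using h
  refine ⟨max n₀ (G.sup N), le_max_left _ _, fun g hg => ?_⟩
  have hle : N g ≤ max n₀ (G.sup N) := (Finset.le_sup hg).trans (le_max_right _ _)
  exact ⟨S.map hle (a g), by rw [hφ.apply_map]; exact ha g⟩

/-- Unital `*`-homomorphisms `τ_m : D_m → B`, with no compatibility between them, induce a
`*`-homomorphism from the inductive limit to `ℓ^∞(B) / c₀(B)`. -/
theorem IsLimit.exists_lift_seqAlgebra (hφ : S.IsLimit φ) {B : Type u} [CStarAlgebra B]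
    (τ : ∀ m, A (S.obj m) →⋆ₐ[ℂ] B) :
    ∃ θ : D →⋆ₐ[ℂ] SeqAlgebra B, ∀ (n : ℕ) (a : A (S.obj n)), ∃ x : BoundedSeq B,
      θ (φ n a) = SeqAlgebra.quot B x ∧ ∀ (m : ℕ) (h : n ≤ m), x m = τ m (S.map h a) := by
  let R : D × SeqAlgebra B → Prop := fun z => ∃ (n : ℕ) (a : A (S.obj n)) (x : BoundedSeq B),
    z.1 = φ n a ∧ z.2 = SeqAlgebra.quot B x ∧ ∀ (m : ℕ) (h : n ≤ m), x m = τ m (S.map h a)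
  -- An element can be moved to a later stage without changing its sequence x, so two related pairs
  -- may be represented at one stage and combined there.
  have hup : ∀ z, R z → ∃ n₀, ∀ n, n₀ ≤ n → ∃ (a : A (S.obj n)) (x : BoundedSeq B),
      z.1 = φ n a ∧ z.2 = SeqAlgebra.quot B x ∧ ∀ (m : ℕ) (h : n ≤ m), x m = τ m (S.map h a) := by
    rintro z ⟨n₀, a, x, h1, h2, h3⟩
    refine ⟨n₀, fun n hn => ⟨S.map hn a, x, ?_, h2, fun m h => ?_⟩⟩
    · rw [hφ.apply_map, h1]
    · rw [map_map, h3 m (hn.trans h)]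
  have hup₂ : ∀ z z', R z → R z' → ∃ (n : ℕ) (a a' : A (S.obj n)) (x x' : BoundedSeq B),
      (z.1 = φ n a ∧ z.2 = SeqAlgebra.quot B x ∧ ∀ (m : ℕ) (h : n ≤ m), x m = τ m (S.map h a)) ∧
      (z'.1 = φ n a' ∧ z'.2 = SeqAlgebra.quot B x' ∧
        ∀ (m : ℕ) (h : n ≤ m), x' m = τ m (S.map h a')) := fun z z' hz hz' => by
    obtain ⟨n₁, h₁⟩ := hup z hz
    obtain ⟨n₂, h₂⟩ := hup z' hz'
    obtain ⟨a, x, h⟩ := h₁ (max n₁ n₂) (le_max_left _ _)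
    obtain ⟨a', x', h'⟩ := h₂ (max n₁ n₂) (le_max_right _ _)
    exact ⟨_, a, a', x, x', h, h'⟩
  let Γ : StarSubalgebra ℂ (D × SeqAlgebra B) :=
    { carrier := {z | R z}
      mul_mem' := fun {z z'} hz hz' => by
        obtain ⟨n, a, a', x, x', ⟨h1, h2, h3⟩, h1', h2', h3'⟩ := hup₂ z z' hz hz'
        exact ⟨n, a * a', x * x', by rw [map_mul, Prod.fst_mul, h1, h1'],
          by rw [map_mul, Prod.snd_mul, h2, h2'], fun m h => by
            rw [BoundedSeq.mul_apply, h3 m h, h3' m h, map_mul, map_mul]⟩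
      add_mem' := fun {z z'} hz hz' => by
        obtain ⟨n, a, a', x, x', ⟨h1, h2, h3⟩, h1', h2', h3'⟩ := hup₂ z z' hz hz'
        exact ⟨n, a + a', x + x', by rw [map_add, Prod.fst_add, h1, h1'],
          by rw [map_add, Prod.snd_add, h2, h2'], fun m h => by
            rw [BoundedSeq.add_apply, h3 m h, h3' m h, map_add, map_add]⟩
      algebraMap_mem' := fun c =>
        ⟨0, algebraMap ℂ _ c, algebraMap ℂ _ c, (AlgHomClass.commutes (φ 0) c).symm,
          (AlgHomClass.commutes (SeqAlgebra.quot B) c).symm, fun m h => by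
            rw [AlgHomClass.commutes, AlgHomClass.commutes]
            rfl⟩
      star_mem' := fun {z} hz => by
        obtain ⟨n, a, x, h1, h2, h3⟩ := hz
        exact ⟨n, star a, star x, by rw [map_star, Prod.fst_star, h1],
          by rw [map_star, Prod.snd_star, h2], fun m h => by
            rw [BoundedSeq.star_apply, h3 m h, map_star, map_star]⟩ }
  have hx : ∀ (n : ℕ) (a : A (S.obj n)), ∃ x : BoundedSeq B,
      ∀ (m : ℕ) (h : n ≤ m), x m = τ m (S.map h a) := fun n a => by
    -- The finitely many terms before n do not affect the class, so 0 is as good as anything.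
    refine ⟨BoundedSeq.mk (fun m => if h : n ≤ m then τ m (S.map h a) else 0) ‖a‖ fun m => ?_,
      fun m h => ?_⟩
    · split_ifs with h
      · exact (NonUnitalStarAlgHom.norm_apply_le _ _).trans
          (NonUnitalStarAlgHom.norm_apply_le _ _)
      · rw [norm_zero]
        exact norm_nonneg a
    · rw [BoundedSeq.mk_apply, dif_pos h]
  -- Each τ_m is contractive, so the limsup is at most lim ‖φ_n^m(a)‖, the norm in the inductive
  -- limit. In particular the class does not depend on the chosen representative.
  have hΓ : ∀ z ∈ Γ, ‖z.2‖ ≤ ‖z.1‖ := by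
    rintro z ⟨n, a, x, h1, h2, h3⟩
    rw [h1, h2]
    refine le_of_forall_gt_imp_ge_of_dense fun c hc => SeqAlgebra.norm_quot_le_of_eventually ?_
    obtain ⟨k₀, hk₀⟩ := eventually_atTop.mp ((hφ.norm_eq n a).eventually_lt_const hc)
    filter_upwards [eventually_ge_atTop (n + k₀)] with m hm
    obtain ⟨k, rfl⟩ := Nat.exists_eq_add_of_le ((Nat.le_add_right n k₀).trans hm)
    rw [h3 _ (Nat.le_add_right n k)]
    exact (NonUnitalStarAlgHom.norm_apply_le _ _).trans (hk₀ k (by omega)).le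
  obtain ⟨θ, hθ⟩ := StarAlgHom.exists_of_contractive_graph Γ hΓ (hφ.dense.mono fun y hy => by
    obtain ⟨n, a, rfl⟩ := Set.mem_iUnion.mp hy
    obtain ⟨x, hx⟩ := hx n a
    exact ⟨(φ n a, SeqAlgebra.quot B x), ⟨n, a, x, rfl, rfl, hx⟩, rfl⟩)
  refine ⟨θ, fun n a => ?_⟩
  obtain ⟨x, hx⟩ := hx n a
  exact ⟨x, hθ (φ n a, SeqAlgebra.quot B x) ⟨n, a, x, rfl, rfl, hx⟩, hx⟩

/-- The members of a weak Fraïssé sequence of a category that weakly dominates a `⊗`-expansion of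
itself map almost centrally into the limit. -/
theorem IsLimit.exists_almost_central (hφ : S.IsLimit φ) (hS : S.IsWeakFraisse)
    (hK : K.IsTensorExpansion C) (hdom : C.WeaklyDominates K) (n₀ : ℕ) (G : Finset D) {ε : ℝ}
    (hε : 0 < ε) : ∃ τ : A (S.obj n₀) →⋆ₐ[ℂ] D, ∀ b, ∀ g ∈ G, ‖τ b * g - g * τ b‖ ≤ ε * ‖b‖ := by
  classical
  have hδ : 0 < ε / 6 := by positivity
  obtain ⟨n, hn, hG⟩ := hφ.exists_norm_sub_lt n₀ G hδ
  have hG' : ∀ g, ∃ a, g ∈ G → ‖φ n a - g‖ < ε / 6 := fun g => by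
    by_cases hg : g ∈ G
    · exact (hG g hg).imp fun a ha _ => ha
    · exact ⟨0, fun h => absurd h hg⟩
  choose a ha using hG'
  -- The order matters: m comes from weak amalgamation first, then ζ out of D_m from weak
  -- domination. The resulting α starts at D_m, so it can be fed back into the amalgamation.
  obtain ⟨m, hm, hweak⟩ := hS.2 (ε / 6) hδ n (G.image a)
  obtain ⟨i, ζ, hζ, hdom'⟩ := hdom.2.2 (ε / 6) hδ (S.obj m) (C.target_mem (S.map_mem hm))
    ((G.image a).image (S.map hm))
  obtain ⟨-, T, e, -, -, hinl, -, -⟩ := hK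
  obtain ⟨l, -, β, -, α, hα, hαβ⟩ := hdom' _ _ (hinl ⟨i, C.target_mem hζ⟩)
  obtain ⟨k, hk, η, -, hη⟩ := hweak l α hα
  let ρ : MinTensor (A i) (A i) →⋆ₐ[ℂ] D := (φ k).comp (η.comp (β.comp
    (e ⟨i, C.target_mem hζ⟩ : MinTensor (A i) (A i) →⋆ₐ[ℂ] A (T ⟨i, C.target_mem hζ⟩))))
  refine ⟨ρ.comp ((MinTensor.inr (A i) (A i)).comp (ζ.comp (S.map (hn.trans hm)))),
    fun b g hg => ?_⟩
  set t := (ρ.comp ((MinTensor.inr (A i) (A i)).comp (ζ.comp (S.map (hn.trans hm))))) b with ht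
  have htb : ‖t‖ ≤ ‖b‖ := NonUnitalStarAlgHom.norm_apply_le _ b
  set c := ρ (MinTensor.inl (A i) (A i) (ζ (S.map hm (a g)))) with hc
  -- Both elements come through the same ρ on A_i ⊗ A_i, from opposite factors, so they commute
  -- exactly; only c ≈ g is approximate.
  have hct : Commute c t := (MinTensor.commute_inl_inr _ _).map ρ
  have h1 : ‖φ n (a g) - φ k (η (α (S.map hm (a g))))‖ < ε / 6 := by
    have h := hη (a g) (Finset.mem_image_of_mem a hg)
    rw [← hφ.apply_map (hm.trans hk.le), ← map_sub]
    exact (NonUnitalStarAlgHom.norm_apply_le _ _).trans_lt h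
  have h2 : ‖φ k (η (α (S.map hm (a g)))) - c‖ < ε / 6 := by
    have h := hαβ (S.map hm (a g))
      (Finset.mem_image_of_mem _ (Finset.mem_image_of_mem a hg))
    have e1 : φ k (η (α (S.map hm (a g)))) - c = ((φ k).comp η) (α (S.map hm (a g)) - _) :=
      (map_sub ((φ k).comp η) _ _).symm
    rw [e1]
    exact (NonUnitalStarAlgHom.norm_apply_le ((φ k).comp η) _).trans_lt h
  -- Three errors of ε/6: approximation at stage n, weak amalgamation, weak domination. The
  -- commutator below uses the total twice.
  have h3 : ‖g - c‖ ≤ ε / 2 := by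
    have h := ha g hg
    rw [norm_sub_rev] at h
    have h4 := norm_sub_le_norm_sub_add_norm_sub g (φ n (a g)) c
    have h5 := norm_sub_le_norm_sub_add_norm_sub (φ n (a g)) (φ k (η (α (S.map hm (a g))))) c
    linarith
  have e2 : t * g - g * t = t * (g - c) - (g - c) * t := by
    rw [mul_sub, sub_mul, hct.eq]
    abel
  have b1 : ‖t * (g - c)‖ ≤ ‖b‖ * (ε / 2) :=
    (norm_mul_le _ _).trans (mul_le_mul htb h3 (norm_nonneg _) (norm_nonneg _))
  have b2 : ‖(g - c) * t‖ ≤ ε / 2 * ‖b‖ :=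
    (norm_mul_le _ _).trans (mul_le_mul h3 htb (norm_nonneg _) (by positivity))
  rw [e2]
  linarith [norm_sub_le (t * (g - c)) ((g - c) * t)]

/-- The limit of a weak Fraïssé sequence of a category that weakly dominates a `⊗`-expansion of
itself maps into its own central sequence algebra. -/
theorem IsLimit.exists_asymptotically_central [TopologicalSpace.SeparableSpace D]
    (hφ : S.IsLimit φ) (hS : S.IsWeakFraisse) (hK : K.IsTensorExpansion C)
    (hdom : C.WeaklyDominates K) :
    ∃ θ : D →⋆ₐ[ℂ] SeqAlgebra D, ∀ a b, Commute (SeqAlgebra.diag D a) (θ b) := by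
  classical
  set d := TopologicalSpace.denseSeq D with hd
  -- τ_m almost commutes with the first m + 1 terms of a dense sequence up to 1/(m + 1), so the
  -- commutators with each fixed term tend to zero.
  choose τ hτ using fun m : ℕ => hφ.exists_almost_central hS hK hdom m
    ((Finset.range (m + 1)).image d) (Nat.one_div_pos_of_nat (α := ℝ) (n := m))
  obtain ⟨θ, hθ⟩ := hφ.exists_lift_seqAlgebra τ
  have hd : ∀ k n (a : A (S.obj n)), Commute (SeqAlgebra.diag D (d k)) (θ (φ n a)) :=
    fun k n a => by
      obtain ⟨x, hx, hx'⟩ := hθ n a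
      rw [hx, SeqAlgebra.diag_apply, Commute, SemiconjBy, ← map_mul, ← map_mul, ← sub_eq_zero,
        ← map_sub, ← norm_le_zero_iff]
      refine le_of_forall_gt_imp_ge_of_dense fun c hc => SeqAlgebra.norm_quot_le_of_eventually ?_
      have hlim : Tendsto (fun m : ℕ => 1 / ((m : ℝ) + 1) * ‖a‖) atTop (𝓝 0) := by
        simpa using tendsto_one_div_add_atTop_nhds_zero_nat.mul_const ‖a‖
      filter_upwards [hlim.eventually_lt_const hc, eventually_ge_atTop n,
        eventually_ge_atTop k] with m hmc hn hk
      have h1 := hτ m (S.map hn a) (d k)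
        (Finset.mem_image_of_mem d (Finset.mem_range_succ_iff.mpr hk))
      rw [BoundedSeq.sub_apply, BoundedSeq.mul_apply, BoundedSeq.mul_apply, hx' m hn,
        BoundedSeq.const_apply, norm_sub_rev]
      refine h1.trans (le_trans ?_ hmc.le)
      gcongr
      exact NonUnitalStarAlgHom.norm_apply_le _ _
  have hcd := (SeqAlgebra.diag D).continuous_of_cstar
  refine ⟨θ, fun a b => ?_⟩
  refine hφ.dense.induction (P := fun b => Commute (SeqAlgebra.diag D a) (θ b)) (fun b hb => ?_)
    (isClosed_eq (continuous_const.mul θ.continuous_of_cstar)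
      (θ.continuous_of_cstar.mul continuous_const)) b
  obtain ⟨n, b, rfl⟩ := Set.mem_iUnion.mp hb
  exact (TopologicalSpace.denseRange_denseSeq D).induction_on
    (p := fun a => Commute (SeqAlgebra.diag D a) (θ (φ n b))) a
    (isClosed_eq (hcd.mul continuous_const) (continuous_const.mul hcd)) fun k => hd k n b

end Sequence

end CStarCategory

/-- The zero algebra is strongly self-absorbing in the sense of the definition. -/
theorem StronglySelfAbsorbing.of_subsingleton {D : Type u} [CStarAlgebra D] [Subsingleton D] :
    StronglySelfAbsorbing D := by
  have h1 : (1 : MinTensor D D) = 0 := by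
    rw [← map_one (MinTensor.inl D D), ← map_zero (MinTensor.inl D D)]
    exact congrArg _ (Subsingleton.elim _ _)
  have : Subsingleton (MinTensor D D) := subsingleton_of_zero_eq_one h1.symm
  refine ⟨inferInstance, fun ⟨f⟩ => ?_, StarAlgEquiv.ofBijective (MinTensor.inl D D)
    ⟨fun _ _ _ => Subsingleton.elim _ _, fun y => ⟨0, Subsingleton.elim _ _⟩⟩, fun _ => 1,
    fun a => ?_⟩
  · exact one_ne_zero (f.symm.injective.subsingleton.elim (1 : ℂ) 0)
  · refine tendsto_const_nhds.congr fun n => ?_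
    rw [Subsingleton.elim (_ - _ : MinTensor D D) 0, norm_zero]

theorem theorem3 {ι : Type v} {A : ι → Type u} [∀ i, CStarAlgebra (A i)]
    [∀ i, TopologicalSpace.SeparableSpace (A i)] (C K : CStarCategory A)
    (hK : K.IsTensorExpansion C) (hdom : C.Dominates K ∨ C.WeaklyDominates K)
    (D : Type u) [CStarAlgebra D] (hlim : C.IsFraisseLimit D ∨ C.IsWeakFraisseLimit D)
    (hflip : HasApproxInnerHalfFlip D) (hD : ¬ Nonempty (D ≃⋆ₐ[ℂ] ℂ)) :
    StronglySelfAbsorbing D := by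
  -- The zero algebra is not excluded by D ≇ ℂ, while the isometry of id ⊗ 1 is obtained for
  -- nontrivial D.
  rcases subsingleton_or_nontrivial D with _ | _
  · exact StronglySelfAbsorbing.of_subsingleton
  obtain ⟨S, hS, φ, hφ⟩ := hlim.elim CStarCategory.IsFraisseLimit.isWeakFraisseLimit id
  have := hφ.separableSpace
  obtain ⟨θ, hθ⟩ := hφ.exists_asymptotically_central hS hK
    (hdom.elim CStarCategory.Dominates.weaklyDominates id)
  exact hflip.stronglySelfAbsorbing hD θ hθ
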